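/- Let $\Bbbk$ be a field and let $G$ be a finite simple graph with vertex set $V$ which is a cograph, i.e. $G$ has no induced path on four vertices. Let $S=\Bbbk[x_v,y_v : v\in V]$ with its standard grading, let $J_G=\langle x_vy_w-y_vx_w : \{v,w\}\in E(G)\rangle\subset S$ be the binomial edge ideal of $G$, and let $$\operatorname{reg}(S/J_G)=\max\{\,j-i : \beta_{i,j}(S/J_G)\neq 0\,\},\qquad \beta_{i,j}(S/J_G)=\dim_{\Bbbk}\operatorname{Tor}_i^S(S/J_G,\Bbbk)_j,$$ be the Castelnuovo--Mumford regularity of $S/J_G$. Let $P_\ell$ denote the path with $\ell$ vertices. Suppose that $G$ has exactly $3k-a$ vertices, where $k\ge 1$ is an integer and $a\in\{0,1\}$. Then $\operatorname{reg}(S/J_G)=2k-a$ if and only if $G$ is isomorphic to a disjoint union of $p$ copies of $P_3$ and $q$ copies of $P_2$ for some integers $p\ge 0$ and $q\in\{0,1\}$. -/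

import Mathlib

open MvPolynomial CategoryTheory

/-! ### Graphs -/

/-- A cograph: a graph with no induced path of length `3`, i.e. no induced path on four vertices. -/
def IsCograph {V : Type*} (G : SimpleGraph V) : Prop :=
  ¬ (SimpleGraph.pathGraph 4).IsIndContained G

/-- The disjoint union of `m` copies of the graph `H`. -/
def graphCopies {W : Type*} (m : ℕ) (H : SimpleGraph W) : SimpleGraph (Fin m × W) where
  Adj p q := p.1 = q.1 ∧ H.Adj p.2 q.2
  symm := ⟨fun _ _ h => ⟨h.1.symm, h.2.symm⟩⟩
  loopless := ⟨fun _ h => H.irrefl h.2⟩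

/-- The binomial edge ideal of `G` in the polynomial ring `S` with two variables
`x_v = X (Sum.inl v)` and `y_v = X (Sum.inr v)` for every vertex `v`; it is generated by the
`2 × 2` minors `x_v y_w - y_v x_w`, for the edges `{v, w}` of `G`. -/
noncomputable def binomialEdgeIdeal (k : Type*) [Field k] {V : Type*} (G : SimpleGraph V) :
    Ideal (MvPolynomial (V ⊕ V) k) :=
  Ideal.span {p | ∃ v w : V, G.Adj v w ∧
    p = X (Sum.inl v) * X (Sum.inr w) - X (Sum.inr v) * X (Sum.inl w)}

/-! ### Graded Betti numbers and regularity

Let `S = k[X_s : s ∈ σ]` with its standard grading, and let `I` be a homogeneous ideal of `S`.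
The graded vector spaces `Tor_i^S(S/I, k)` are computed from the free resolution of the residue
field `k = S/(X_s : s ∈ σ)` by the Koszul complex `K` of the variables, as the homology of
`S/I ⊗_S K`.  Its `i`-th term is `S/I ⊗_k Λ^i(k^σ)`, where `Λ^i(k^σ)` has degree `i`. -/

section Koszul

variable {k : Type*} [Field k] {σ : Type*}

/-- The homogeneous component `(S/I)_d` of degree `d ∈ ℤ` (it is zero for `d < 0`). -/
noncomputable def quotientDegree (I : Ideal (MvPolynomial σ k)) (d : ℤ) :
    Submodule k (MvPolynomial σ k ⧸ I) :=
  if 0 ≤ d then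
    (homogeneousSubmodule σ k d.toNat).map (Ideal.Quotient.mkₐ k I).toLinearMap
  else ⊥

theorem X_smul_mem_quotientDegree (I : Ideal (MvPolynomial σ k)) (s : σ) {d : ℤ}
    {f : MvPolynomial σ k ⧸ I} (hf : f ∈ quotientDegree I d) :
    (X s : MvPolynomial σ k) • f ∈ quotientDegree I (d + 1) := by
  unfold quotientDegree at hf ⊢
  split_ifs at hf with h0
  · obtain ⟨p, hp, rfl⟩ := hf
    rw [if_pos (by omega)]
    refine ⟨X s * p, ?_, ?_⟩
    · have h1 := (isHomogeneous_X k s).mul ((mem_homogeneousSubmodule _ _).1 hp)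
      have e : (d + 1).toNat = 1 + d.toNat := by omega
      rw [e]
      exact (mem_homogeneousSubmodule _ _).2 h1
    · rfl
  · rw [(Submodule.mem_bot k).1 hf, smul_zero]
    exact Submodule.zero_mem _

/-- The term `S/I ⊗_k Λ^i(k^σ)` of the Koszul complex, written as the space of alternating
`i`-forms on `k^σ` with values in `S/I`: the form `c` stands for the element
`∑ c(e_{s_1}, …, e_{s_i}) ⊗ e_{s_1} ∧ … ∧ e_{s_i}`, the sum being over the `i`-element subsets
`{s_1 < … < s_i}` of `σ` (it does not depend on the order of `σ`). -/
abbrev KoszulForm (I : Ideal (MvPolynomial σ k)) (i : ℕ) :=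
  (σ → k) [⋀^Fin i]→ₗ[k] (MvPolynomial σ k ⧸ I)

variable [Fintype σ] [DecidableEq σ]

/-- The Koszul differential
`a ⊗ e_{s_0} ∧ … ∧ e_{s_i} ↦ ∑_r (-1)^r X_{s_r} a ⊗ e_{s_0} ∧ … ê_{s_r} … ∧ e_{s_i}`,
which on forms reads `(∂c)(v_1, …, v_i) = ∑_s X_s c(e_s, v_1, …, v_i)`. -/
noncomputable def koszulDifferential (I : Ideal (MvPolynomial σ k)) (i : ℕ) :
    KoszulForm I (i + 1) →ₗ[k] KoszulForm I i where
  toFun c := ∑ s, (X s : MvPolynomial σ k) • c.curryLeft (Pi.single s 1)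
  map_add' c c' := by
    simp [AlternatingMap.curryLeft_add, Finset.sum_add_distrib]
  map_smul' a c := by
    simp only [AlternatingMap.curryLeft_smul, RingHom.id_apply, Finset.smul_sum,
      LinearMap.smul_apply]
    exact Finset.sum_congr rfl fun s _ => smul_comm _ _ _

theorem koszulDifferential_apply (I : Ideal (MvPolynomial σ k)) (i : ℕ)
    (c : KoszulForm I (i + 1)) (v : Fin i → σ → k) :
    koszulDifferential I i c v =
      ∑ s, (X s : MvPolynomial σ k) • c (Matrix.vecCons (Pi.single s 1) v) := by
  let ev : KoszulForm I i →+ (MvPolynomial σ k ⧸ I) := ⟨⟨fun f => f v, rfl⟩, fun _ _ => rfl⟩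
  exact map_sum ev _ _

theorem koszulDifferential_comp (I : Ideal (MvPolynomial σ k)) (i : ℕ)
    (c : KoszulForm I (i + 2)) :
    koszulDifferential I i (koszulDifferential I (i + 1) c) = 0 := by
  ext v
  rw [koszulDifferential_apply]
  simp only [koszulDifferential_apply, Finset.smul_sum, smul_smul]
  rw [← Finset.sum_product', AlternatingMap.zero_apply]
  refine Finset.sum_involution (fun p _ => (p.2, p.1)) ?_ ?_ ?_ ?_
  · rintro ⟨s, t⟩ _
    have h := c.map_swap
      (Matrix.vecCons (Pi.single t 1) (Matrix.vecCons (Pi.single s 1) v))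
      (i := 0) (j := 1) (by simp)
    have e : Matrix.vecCons (Pi.single t (1 : k)) (Matrix.vecCons (Pi.single s 1) v) ∘
        Equiv.swap 0 1 = Matrix.vecCons (Pi.single s 1) (Matrix.vecCons (Pi.single t 1) v) := by
      funext r
      refine Fin.cases ?_ (fun r => Fin.cases ?_ (fun r => ?_) r) r
      · simp
      · simp
      · rw [Function.comp_apply, Equiv.swap_apply_of_ne_of_ne]
        · simp
        · simp
        · simp [Fin.ext_iff]
    rw [e] at h
    simp only [h, smul_neg, mul_comm (X t : MvPolynomial σ k), add_neg_cancel]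
  · rintro ⟨s, t⟩ _ h e
    obtain rfl : t = s := (Prod.mk.inj e).1
    exact h (by rw [c.map_eq_zero_of_eq _ (i := 0) (j := 1) (by simp) (by simp), smul_zero])
  · simp
  · simp

/-- The elements of (total) degree `j` in `S/I ⊗_k Λ^i(k^σ)`: the coefficients have degree
`j - i`. -/
noncomputable def koszulDegree (I : Ideal (MvPolynomial σ k)) (j i : ℕ) :
    Submodule k (KoszulForm I i) where
  carrier := {c | ∀ v, c v ∈ quotientDegree I ((j : ℤ) - i)}
  zero_mem' _ := Submodule.zero_mem _
  add_mem' h h' v := Submodule.add_mem _ (h v) (h' v)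
  smul_mem' a _ h v := Submodule.smul_mem _ a (h v)

theorem koszulDifferential_mem (I : Ideal (MvPolynomial σ k)) (j i : ℕ)
    (c : KoszulForm I (i + 1)) (hc : c ∈ koszulDegree I j (i + 1)) :
    koszulDifferential I i c ∈ koszulDegree I j i := by
  intro v
  rw [koszulDifferential_apply]
  refine Submodule.sum_mem _ fun s _ => ?_
  have h := X_smul_mem_quotientDegree I s (hc (Matrix.vecCons (Pi.single s 1) v))
  have e : (j : ℤ) - ((i + 1 : ℕ) : ℤ) + 1 = (j : ℤ) - i := by push_cast; ring
  rwa [e] at h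

/-- The degree `j` part of the complex `S/I ⊗_S K`, a complex of `k`-vector spaces. -/
noncomputable def koszulComplex (I : Ideal (MvPolynomial σ k)) (j : ℕ) :
    ChainComplex (ModuleCat k) ℕ :=
  ChainComplex.of (fun i => ModuleCat.of k (koszulDegree I j i))
    (fun i => ModuleCat.ofHom
      ((koszulDifferential I i).restrict (koszulDifferential_mem I j i)))
    (fun i => ModuleCat.hom_ext (LinearMap.ext fun c =>
      Subtype.ext (koszulDifferential_comp I i c.1)))

/-- `Tor_i^S(S/I, k)_j`. -/
noncomputable def gradedTor (I : Ideal (MvPolynomial σ k)) (i j : ℕ) : ModuleCat k :=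
  (koszulComplex I j).homology i

/-- The graded Betti number `β_{i,j}(S/I) = dim_k Tor_i^S(S/I, k)_j`. -/
noncomputable def gradedBetti (I : Ideal (MvPolynomial σ k)) (i j : ℕ) : ℕ :=
  Module.finrank k (gradedTor I i j)

/-- The Castelnuovo-Mumford regularity `reg(S/I) = max {j - i : β_{i,j}(S/I) ≠ 0}`. -/
noncomputable def regularity (I : Ideal (MvPolynomial σ k)) : ℤ :=
  sSup {r : ℤ | ∃ i j : ℕ, gradedBetti I i j ≠ 0 ∧ r = (j : ℤ) - i}

end Koszul

/-!
The proof stays in the polynomial ring `S = k[x_v, y_v]` and uses no free resolutions of `S/J_G`: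
the Koszul complex of `S/I` is lifted to alternating forms with values in `S` (`PolyForm`), and the
vanishing of `Tor_i(S/I, k)` in degree `i + d` becomes the statement `KoszulExactAt I i d` that
cycles modulo `I` are boundaries modulo `I` (`gradedBetti_eq_zero_iff`). Two facts about it carry
everything.

* `KoszulExactAt.inf`: the sequence `0 → S/(I ∩ J) → S/I ⊕ S/J → S/(I + J) → 0` gives
  `reg S/(I ∩ J) ≤ max (reg S/I, reg S/J, reg S/(I + J) + 1)`.
* `KoszulExactAt.of_sup_span`: if `f` is homogeneous of positive degree and regular modulo `I`, then
  `Tor_{i+1}(S/(I + f))` maps onto `Tor_i(S/I)`, with a shift of degrees by `deg f`, because `f`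
  acts as zero on Koszul homology.

*Upper bound.* A cograph with at least two vertices is a disjoint union or a join of two smaller
ones (`HasNoInducedP4.isSplitBy`). Tensor products are avoided by bounding the regularity of
`J_{G[U]} + L`, where `L` is any homogeneous ideal that does not involve the variables of `U`
(`EdgeRegLE`); with this formulation the bounds for disjoint unions simply add up
(`EdgeRegLE.disjoint_union`). For a complete graph, `x_n` is regular modulo the ideal of minors, and
adding it yields an intersection of an ideal of variables with the ideal of a smaller complete
graph, whence the bound `1` (`RegLE.complete_sup`). For the join of `U₁` and `U₂`, the Plücker
relations show that the edge ideal is the intersection of `(x_v, y_v : v ∈ U₁) + J_{U₂}`,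
`(x_v, y_v : v ∈ U₂) + J_{U₁}` and the ideal of the complete graph (`joinEdgeIdeal_eq_inf`), whence
the bound `max (2, ρ₁, ρ₂)` (`EdgeRegLE.join`). So a cograph on `n` vertices has a bound `ρ` with
`3 ρ ≤ 2 n`. The defect `2 n - 3 ρ` is additive on components; it is `0` for `P₃`, `1` for `P₂`,
and at least `2` for all other connected cographs (`HasNoInducedP4.exists_edgeRegLE`). Regularity
`2 m - a` with `3 m - a` vertices forces the defect to be at most `1`.

*Lower bound.* For `p` copies of `P₃` and `q` copies of `P₂` the binomials of the edges, taken one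
after the other, are each regular modulo the previous ones, so `KoszulExactAt.of_sup_span` moves the
nonzero class of `Tor_0(S, k)` up to `Tor_c` in degree `2 c`, where `c = 2 p + q`
(`not_koszulExactAt_of_isInducedCopy`).
-/

/-! ### Ideals that are homogeneous for a weight -/

section WeightedHomogeneousIdeals

variable {R σ M : Type*} [CommRing R] [AddCommMonoid M]

/-- An ideal is homogeneous for the weight `w` if it contains the `w`-homogeneous components of
its elements. -/
def IsWeightedHomogeneousIdeal (w : σ → M) (I : Ideal (MvPolynomial σ R)) : Prop :=
  ∀ f ∈ I, ∀ m, weightedHomogeneousComponent w m f ∈ I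

theorem isWeightedHomogeneousIdeal_span (w : σ → M) {T : Set (MvPolynomial σ R)}
    (hT : ∀ f ∈ T, ∃ m, IsWeightedHomogeneous w f m) :
    IsWeightedHomogeneousIdeal w (Ideal.span T) := by
  classical
  let _ := weightedGradedAlgebra R w
  intro f hf m
  exact weightedHomogeneousComponent_mem_of_mem R w
    (Ideal.homogeneous_span (weightedHomogeneousSubmodule R w) T hT) hf m

theorem IsWeightedHomogeneousIdeal.sup {w : σ → M} {I J : Ideal (MvPolynomial σ R)}
    (hI : IsWeightedHomogeneousIdeal w I) (hJ : IsWeightedHomogeneousIdeal w J) :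
    IsWeightedHomogeneousIdeal w (I ⊔ J) := by
  intro f hf m
  obtain ⟨a, ha, b, hb, rfl⟩ := Submodule.mem_sup.1 hf
  rw [map_add]
  exact Submodule.add_mem_sup (hI a ha m) (hJ b hb m)

theorem IsWeightedHomogeneousIdeal.inf {w : σ → M} {I J : Ideal (MvPolynomial σ R)}
    (hI : IsWeightedHomogeneousIdeal w I) (hJ : IsWeightedHomogeneousIdeal w J) :
    IsWeightedHomogeneousIdeal w (I ⊓ J) :=
  fun f hf m => ⟨hI f hf.1 m, hJ f hf.2 m⟩

theorem weightedHomogeneousComponent_mul_left [IsCancelAdd M] {w : σ → M} {f : MvPolynomial σ R}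
    {m : M} (hf : IsWeightedHomogeneous w f m) (g : MvPolynomial σ R) (n : M) :
    weightedHomogeneousComponent w (m + n) (f * g) = f * weightedHomogeneousComponent w n g := by
  classical
  induction g using MvPolynomial.induction_on' with
  | monomial d a =>
    have hd := isWeightedHomogeneous_monomial w d a rfl
    rw [weightedHomogeneousComponent_of_mem (hf.mul hd), weightedHomogeneousComponent_of_mem hd]
    simp only [add_right_inj, mul_ite, mul_zero]
  | add p q hp hq => rw [mul_add, map_add, map_add, hp, hq, mul_add]

end WeightedHomogeneousIdeals

/-! ### Koszul forms with polynomial values -/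

section PolynomialForms

variable {k : Type*} [Field k] {σ : Type*}

/-- The homogeneous polynomials of degree `d ∈ ℤ` (only `0` when `d < 0`). -/
noncomputable def polyDegree (k : Type*) [Field k] (σ : Type*) (d : ℤ) :
    Submodule k (MvPolynomial σ k) :=
  weightedHomogeneousSubmodule k (fun _ => 1) d

theorem mem_polyDegree_natCast {n : ℕ} {p : MvPolynomial σ k} :
    p ∈ polyDegree k σ n ↔ p.IsHomogeneous n := by
  have h (d : σ →₀ ℕ) : Finsupp.weight (fun _ => (1 : ℤ)) d = (Finsupp.weight 1 d : ℕ) := by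
    simp [Finsupp.weight_apply, Finsupp.sum]
  simp only [polyDegree, mem_weightedHomogeneousSubmodule, IsWeightedHomogeneous, IsHomogeneous, h,
    Nat.cast_inj]

theorem polyDegree_of_neg {d : ℤ} (hd : d < 0) : polyDegree k σ d = ⊥ := by
  rw [eq_bot_iff]
  intro p hp
  rw [Submodule.mem_bot]
  by_contra h
  obtain ⟨m, hm⟩ := MvPolynomial.ne_zero_iff.1 h
  have := hp hm
  simp only [Finsupp.weight_apply, mul_one, Finsupp.sum, nsmul_eq_mul] at this
  have h0 : (0 : ℤ) ≤ ∑ x ∈ m.support, (m x : ℤ) := by positivity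
  omega

theorem quotientDegree_eq_map (I : Ideal (MvPolynomial σ k)) (d : ℤ) :
    quotientDegree I d = (polyDegree k σ d).map (Ideal.Quotient.mkₐ k I).toLinearMap := by
  unfold quotientDegree
  split_ifs with h
  · lift d to ℕ using h
    congr 1
    ext p
    rw [mem_polyDegree_natCast, Int.toNat_natCast, mem_homogeneousSubmodule]
  · rw [polyDegree_of_neg (not_le.1 h), Submodule.map_bot]

theorem mul_mem_polyDegree {d e : ℤ} {p q : MvPolynomial σ k} (hp : p ∈ polyDegree k σ d)
    (hq : q ∈ polyDegree k σ e) : p * q ∈ polyDegree k σ (d + e) :=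
  IsWeightedHomogeneous.mul hp hq

theorem X_mem_polyDegree (s : σ) : (X s : MvPolynomial σ k) ∈ polyDegree k σ 1 :=
  isWeightedHomogeneous_X k _ s

/-- Alternating forms on `k^σ` with polynomial values; they lift the terms of the Koszul complexes
of all the quotients of the polynomial ring. -/
abbrev PolyForm (k : Type*) [Field k] (σ : Type*) (i : ℕ) :=
  (σ → k) [⋀^Fin i]→ₗ[k] MvPolynomial σ k

/-- The reduction of a polynomial form modulo an ideal. -/
noncomputable def PolyForm.reduce (I : Ideal (MvPolynomial σ k)) {i : ℕ} (c : PolyForm k σ i) :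
    KoszulForm I i :=
  (Ideal.Quotient.mkₐ k I).toLinearMap.compAlternatingMap c

theorem PolyForm.reduce_apply (I : Ideal (MvPolynomial σ k)) {i : ℕ} (c : PolyForm k σ i)
    (v : Fin i → σ → k) : c.reduce I v = Ideal.Quotient.mk I (c v) := rfl

/-- A form with values in the image of a submodule lifts to a form with values in that
submodule: a surjection of vector spaces has a linear section. -/
theorem exists_alternating_lift {E M N : Type*} [AddCommGroup E] [Module k E] [AddCommGroup M]
    [Module k M] [AddCommGroup N] [Module k N] {i : ℕ} (φ : M →ₗ[k] N) (P : Submodule k M)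
    (c : E [⋀^Fin i]→ₗ[k] N) (hc : ∀ v, c v ∈ P.map φ) :
    ∃ b : E [⋀^Fin i]→ₗ[k] M, (∀ v, b v ∈ P) ∧ ∀ v, φ (b v) = c v := by
  let ψ : P →ₗ[k] P.map φ := φ.submoduleMap P
  obtain ⟨g, hg⟩ := ψ.exists_rightInverse_of_surjective
    (LinearMap.range_eq_top.2 (φ.submoduleMap_surjective P))
  refine ⟨(P.subtype ∘ₗ g).compAlternatingMap (c.codRestrict _ hc), fun v => ?_, fun v => ?_⟩
  · exact (g _).2
  · have := congrArg Subtype.val (LinearMap.congr_fun hg ⟨c v, hc v⟩)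
    exact this

variable [Fintype σ] [DecidableEq σ]

/-- The Koszul differential on polynomial forms. -/
noncomputable def polyDifferential {i : ℕ} (c : PolyForm k σ (i + 1)) : PolyForm k σ i :=
  ∑ s, (X s : MvPolynomial σ k) • c.curryLeft (Pi.single s 1)

theorem polyDifferential_apply {i : ℕ} (c : PolyForm k σ (i + 1)) (v : Fin i → σ → k) :
    polyDifferential c v = ∑ s, X s * c (Matrix.vecCons (Pi.single s 1) v) := by
  let ev : PolyForm k σ i →+ MvPolynomial σ k := ⟨⟨fun f => f v, rfl⟩, fun _ _ => rfl⟩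
  exact map_sum ev _ _

theorem reduce_polyDifferential (I : Ideal (MvPolynomial σ k)) {i : ℕ}
    (c : PolyForm k σ (i + 1)) :
    (polyDifferential c).reduce I = koszulDifferential I i (c.reduce I) := by
  ext v
  rw [PolyForm.reduce_apply, koszulDifferential_apply, polyDifferential_apply, map_sum]
  rfl

theorem polyDifferential_sub {i : ℕ} (b c : PolyForm k σ (i + 1)) :
    polyDifferential (b - c) = polyDifferential b - polyDifferential c := by
  ext1 v
  simp [polyDifferential_apply, mul_sub, Finset.sum_sub_distrib]

theorem polyDifferential_comp {i : ℕ} (c : PolyForm k σ (i + 2)) :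
    polyDifferential (polyDifferential c) = 0 := by
  ext1 v
  -- This is the corresponding identity in the Koszul complex of `S/0`.
  have h := koszulDifferential_comp ⊥ i (c.reduce ⊥)
  rw [← reduce_polyDifferential, ← reduce_polyDifferential] at h
  have h2 := congrArg (fun f => f v) h
  simpa [PolyForm.reduce_apply, Ideal.Quotient.eq_zero_iff_mem] using h2

theorem polyDifferential_mem_ideal {I : Ideal (MvPolynomial σ k)} {i : ℕ}
    {c : PolyForm k σ (i + 1)} (hc : ∀ v, c v ∈ I) (v : Fin i → σ → k) :
    polyDifferential c v ∈ I := by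
  rw [polyDifferential_apply]
  exact I.sum_mem fun s _ => I.mul_mem_left _ (hc _)

theorem polyDifferential_mem_polyDegree {d : ℤ} {i : ℕ} {c : PolyForm k σ (i + 1)}
    (hc : ∀ v, c v ∈ polyDegree k σ d) (v : Fin i → σ → k) :
    polyDifferential c v ∈ polyDegree k σ (d + 1) := by
  rw [polyDifferential_apply, add_comm]
  exact Submodule.sum_mem _ fun s _ => mul_mem_polyDegree (X_mem_polyDegree s) (hc _)

/-- A polynomial form is a cycle modulo `I` if its differential vanishes modulo `I`. -/
def IsCycleMod (I : Ideal (MvPolynomial σ k)) : ∀ {i : ℕ}, PolyForm k σ i → Prop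
  | 0, _ => True
  | _ + 1, c => ∀ v, polyDifferential c v ∈ I

theorem IsCycleMod.mono {I J : Ideal (MvPolynomial σ k)} (h : I ≤ J) :
    ∀ {i : ℕ} {c : PolyForm k σ i}, IsCycleMod I c → IsCycleMod J c
  | 0, _, _ => trivial
  | _ + 1, _, hc => fun v => h (hc v)

/-- Exactness of the Koszul complex of `S/I` at `S/I ⊗ Λ^i`, for coefficients of degree `d`,
stated with lifts to polynomial forms. It says that `Tor_i(S/I, k)` vanishes in degree `i + d`. -/
def KoszulExactAt (I : Ideal (MvPolynomial σ k)) (i : ℕ) (d : ℤ) : Prop :=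
  ∀ c : PolyForm k σ i, (∀ v, c v ∈ polyDegree k σ d) → IsCycleMod I c →
    ∃ b : PolyForm k σ (i + 1), (∀ v, b v ∈ polyDegree k σ (d - 1)) ∧
      ∀ v, c v - polyDifferential b v ∈ I

end PolynomialForms

/-! ### Betti numbers through polynomial forms -/

section Bridge

variable {k : Type*} [Field k] {σ : Type*}

theorem exists_lift_of_mem_koszulDegree {I : Ideal (MvPolynomial σ k)} {j i : ℕ}
    {c : KoszulForm I i} (hc : c ∈ koszulDegree I j i) :
    ∃ b : PolyForm k σ i, (∀ v, b v ∈ polyDegree k σ ((j : ℤ) - i)) ∧ b.reduce I = c := by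
  obtain ⟨b, hb, hbc⟩ := exists_alternating_lift (Ideal.Quotient.mkₐ k I).toLinearMap
    (polyDegree k σ ((j : ℤ) - i)) c (fun v => by rw [← quotientDegree_eq_map]; exact hc v)
  exact ⟨b, hb, AlternatingMap.ext hbc⟩

theorem reduce_mem_koszulDegree {I : Ideal (MvPolynomial σ k)} {j i : ℕ} {b : PolyForm k σ i}
    (hb : ∀ v, b v ∈ polyDegree k σ ((j : ℤ) - i)) : b.reduce I ∈ koszulDegree I j i := by
  intro v
  rw [quotientDegree_eq_map]
  exact ⟨b v, hb v, rfl⟩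

theorem reduce_eq_iff {I : Ideal (MvPolynomial σ k)} {i : ℕ} {b c : PolyForm k σ i} :
    b.reduce I = c.reduce I ↔ ∀ v, c v - b v ∈ I := by
  rw [AlternatingMap.ext_iff]
  refine forall_congr' fun v => ?_
  rw [PolyForm.reduce_apply, PolyForm.reduce_apply, eq_comm, Ideal.Quotient.eq]

theorem reduce_eq_zero_iff {I : Ideal (MvPolynomial σ k)} {i : ℕ} {b : PolyForm k σ i} :
    b.reduce I = 0 ↔ ∀ v, b v ∈ I := by
  rw [AlternatingMap.ext_iff]
  refine forall_congr' fun v => ?_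
  rw [PolyForm.reduce_apply, AlternatingMap.zero_apply, Ideal.Quotient.eq_zero_iff_mem]

theorem finite_alternatingMap (E N : Type*) [AddCommGroup E] [Module k E] [AddCommGroup N]
    [Module k N] [Module.Finite k E] [Module.Finite k N] (i : ℕ) :
    Module.Finite k (E [⋀^Fin i]→ₗ[k] N) := by
  have : IsNoetherian k (MultilinearMap k (fun _ : Fin i => E) N) :=
    @isNoetherian_of_isNoetherianRing_of_finite k _ _ MultilinearMap.instAddCommGroup _ _
      Module.Finite.multilinearMap
  exact Module.Finite.of_injective (AlternatingMap.toMultilinearMapLM (S := k))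
    AlternatingMap.coe_multilinearMap_injective

variable [Fintype σ]

instance finite_quotientDegree (I : Ideal (MvPolynomial σ k)) (d : ℤ) :
    Module.Finite k (quotientDegree I d) := by
  refine Module.Finite.iff_fg.2 ?_
  unfold quotientDegree
  split_ifs
  · exact Submodule.FG.map _ (weightedHomogeneousSubmodule_fg k 1 (by simp) _)
  · exact Submodule.fg_bot

variable [DecidableEq σ]

instance finite_koszulDegree (I : Ideal (MvPolynomial σ k)) (j i : ℕ) :
    Module.Finite k (koszulDegree I j i) := by
  have := finite_alternatingMap (k := k) (σ → k) (quotientDegree I ((j : ℤ) - i)) i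
  let φ : koszulDegree I j i →ₗ[k] (σ → k) [⋀^Fin i]→ₗ[k] quotientDegree I ((j : ℤ) - i) :=
    { toFun c := c.1.codRestrict _ c.2
      map_add' _ _ := rfl
      map_smul' _ _ := rfl }
  have : IsNoetherian k ((σ → k) [⋀^Fin i]→ₗ[k] quotientDegree I ((j : ℤ) - i)) :=
    @isNoetherian_of_isNoetherianRing_of_finite k _ _ AlternatingMap.instAddCommGroup _ _ this
  refine Module.Finite.of_injective φ fun c c' h => Subtype.ext (AlternatingMap.ext fun v => ?_)
  exact congrArg Subtype.val (congrArg (fun f => f v) h)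

instance finite_gradedTor (I : Ideal (MvPolynomial σ k)) (i j : ℕ) :
    Module.Finite k (gradedTor I i j) := by
  have : Module.Finite k ((koszulComplex I j).sc i).X₂ := finite_koszulDegree I j i
  have e := ((koszulComplex I j).sc i).moduleCatHomologyIso.toLinearEquiv
  have : Module.Finite k ((koszulComplex I j).sc i).moduleCatLeftHomologyData.H := by
    change Module.Finite k (_ ⧸ LinearMap.range ((koszulComplex I j).sc i).moduleCatToCycles)
    infer_instance
  exact Module.Finite.equiv e.symm

theorem gradedBetti_eq_zero_iff_exactAt (I : Ideal (MvPolynomial σ k)) (i j : ℕ) :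
    gradedBetti I i j = 0 ↔ (koszulComplex I j).ExactAt i := by
  rw [HomologicalComplex.exactAt_iff_isZero_homology, gradedBetti,
    Module.finrank_zero_iff, ModuleCat.isZero_iff_subsingleton]
  rfl

theorem koszulComplex_d (I : Ideal (MvPolynomial σ k)) (i j : ℕ) :
    (koszulComplex I j).d (i + 1) i = ModuleCat.ofHom
      ((koszulDifferential I i).restrict (koszulDifferential_mem I j i)) :=
  by
  simp [koszulComplex]

/-- The graded Betti numbers, defined through the Koszul complex of the quotient ring, vanish
exactly when the corresponding cycles of polynomial forms are boundaries modulo the ideal. -/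
theorem gradedBetti_eq_zero_iff (I : Ideal (MvPolynomial σ k)) (i j : ℕ) :
    gradedBetti I i j = 0 ↔ KoszulExactAt I i ((j : ℤ) - i) := by
  have e : (j : ℤ) - i - 1 = (j : ℤ) - (i + 1 : ℕ) := by push_cast; ring
  have key : (koszulComplex I j).ExactAt i ↔ ∀ c : PolyForm k σ i,
      (∀ v, c v ∈ polyDegree k σ ((j : ℤ) - i)) → IsCycleMod I c →
        ∃ b ∈ koszulDegree I j (i + 1), koszulDifferential I i b = c.reduce I := by
    cases i with
    | zero =>
      rw [HomologicalComplex.exactAt_iff' _ 1 0 0 (by simp) (by simp),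
        ShortComplex.moduleCat_exact_iff]
      constructor
      · intro h c hc _
        obtain ⟨b, hb⟩ := h ⟨c.reduce I, reduce_mem_koszulDegree hc⟩ (by
          change ((koszulComplex I j).d 0 0).hom _ = 0
          rw [(koszulComplex I j).shape 0 0 (by simp)]
          rfl)
        change ((koszulComplex I j).d 1 0).hom _ = _ at hb
        rw [koszulComplex_d] at hb
        exact ⟨b.1, b.2, congrArg Subtype.val hb⟩
      · intro h c _
        obtain ⟨c', hc', hcc⟩ := exists_lift_of_mem_koszulDegree c.2
        obtain ⟨b, hb, hbc⟩ := h c' hc' trivial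
        refine ⟨⟨b, hb⟩, ?_⟩
        change ((koszulComplex I j).d 1 0).hom _ = _
        rw [koszulComplex_d]
        exact Subtype.ext (hbc.trans hcc)
    | succ i =>
      rw [HomologicalComplex.exactAt_iff' _ (i + 2) (i + 1) i (by simp) (by simp),
        ShortComplex.moduleCat_exact_iff]
      constructor
      · intro h c hc hcyc
        obtain ⟨b, hb⟩ := h ⟨c.reduce I, reduce_mem_koszulDegree hc⟩ (by
          change ((koszulComplex I j).d (i + 1) i).hom _ = 0
          rw [koszulComplex_d]
          refine Subtype.ext ?_
          change koszulDifferential I i (c.reduce I) = 0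
          rw [← reduce_polyDifferential, reduce_eq_zero_iff]
          exact hcyc)
        change ((koszulComplex I j).d (i + 2) (i + 1)).hom _ = _ at hb
        rw [koszulComplex_d] at hb
        exact ⟨b.1, b.2, congrArg Subtype.val hb⟩
      · intro h c hcyc
        change ((koszulComplex I j).d (i + 1) i).hom _ = 0 at hcyc
        rw [koszulComplex_d] at hcyc
        obtain ⟨c', hc', hcc⟩ := exists_lift_of_mem_koszulDegree c.2
        obtain ⟨b, hb, hbc⟩ := h c' hc' (by
          change ∀ v, polyDifferential c' v ∈ I
          rw [← reduce_eq_zero_iff, reduce_polyDifferential, hcc]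
          exact congrArg Subtype.val hcyc)
        refine ⟨⟨b, hb⟩, ?_⟩
        change ((koszulComplex I j).d (i + 2) (i + 1)).hom _ = _
        rw [koszulComplex_d]
        exact Subtype.ext (hbc.trans hcc)
  rw [gradedBetti_eq_zero_iff_exactAt, key]
  refine forall_congr' fun c => imp_congr_right fun _ => imp_congr_right fun _ => ?_
  constructor
  · rintro ⟨b, hb, hbc⟩
    obtain ⟨b', hb', rfl⟩ := exists_lift_of_mem_koszulDegree hb
    refine ⟨b', fun v => e ▸ hb' v, ?_⟩
    rw [← reduce_polyDifferential, reduce_eq_iff] at hbc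
    exact hbc
  · rintro ⟨b, hb, hbc⟩
    refine ⟨b.reduce I, reduce_mem_koszulDegree fun v => e ▸ hb v, ?_⟩
    rw [← reduce_polyDifferential, reduce_eq_iff]
    exact hbc

end Bridge

/-! ### Intersections, regular elements and bounds for the regularity -/

section RegularityBounds

variable {k : Type*} [Field k] {σ : Type*}

/-- Homogeneity of an ideal for the standard grading, which is indexed by `ℤ` like the degrees of
Koszul forms. -/
abbrev IsHomogeneousIdeal (I : Ideal (MvPolynomial σ k)) : Prop :=
  IsWeightedHomogeneousIdeal (fun _ => (1 : ℤ)) I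

theorem isHomogeneousIdeal_bot : IsHomogeneousIdeal (⊥ : Ideal (MvPolynomial σ k)) := by
  intro f hf m
  rw [Ideal.mem_bot.1 hf, map_zero]
  exact Ideal.zero_mem _

theorem exists_add_eq_of_mem_sup {I J : Ideal (MvPolynomial σ k)} (hI : IsHomogeneousIdeal I)
    (hJ : IsHomogeneousIdeal J) {d : ℤ} {p : MvPolynomial σ k} (hp : p ∈ I ⊔ J)
    (hd : p ∈ polyDegree k σ d) :
    ∃ a ∈ I, ∃ b ∈ J, a ∈ polyDegree k σ d ∧ b ∈ polyDegree k σ d ∧ a + b = p := by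
  obtain ⟨a, ha, b, hb, rfl⟩ := Submodule.mem_sup.1 hp
  refine ⟨_, hI a ha d, _, hJ b hb d, weightedHomogeneousComponent_mem _ _ _,
    weightedHomogeneousComponent_mem _ _ _, ?_⟩
  rw [← map_add, weightedHomogeneousComponent_eq_self hd]

theorem exists_add_mul_eq_of_mem_sup_span {I : Ideal (MvPolynomial σ k)}
    (hI : IsHomogeneousIdeal I) {d e : ℤ} {f p : MvPolynomial σ k} (hf : f ∈ polyDegree k σ e)
    (hp : p ∈ I ⊔ Ideal.span {f}) (hd : p ∈ polyDegree k σ (e + d)) :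
    ∃ a ∈ I, ∃ b, a ∈ polyDegree k σ (e + d) ∧ b ∈ polyDegree k σ d ∧ a + f * b = p := by
  obtain ⟨a, ha, b, hb, rfl⟩ := Submodule.mem_sup.1 hp
  obtain ⟨b, rfl⟩ := Ideal.mem_span_singleton'.1 hb
  refine ⟨_, hI a ha (e + d), _, weightedHomogeneousComponent_mem _ _ _,
    weightedHomogeneousComponent_mem _ b d, ?_⟩
  rw [← weightedHomogeneousComponent_mul_left hf, ← map_add, mul_comm f,
    weightedHomogeneousComponent_eq_self hd]

variable [Fintype σ]

/-- The exterior product `g ∧ c` of the linear form with coefficients `g` and a form `c`. -/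
noncomputable def wedgeLinear (g : σ → MvPolynomial σ k) {i : ℕ} (c : PolyForm k σ i) :
    PolyForm k σ (i + 1) :=
  AlternatingMap.alternatizeUncurryFin
    { toFun x := (∑ s, C (x s) * g s) • c
      map_add' x y := by simp [add_mul, Finset.sum_add_distrib, add_smul]
      map_smul' a x := by
        simp only [Pi.smul_apply, smul_eq_mul, C_mul, mul_assoc, ← Finset.mul_sum, mul_smul,
          RingHom.id_apply]
        ext1 v
        simp [C_mul'] }

theorem wedgeLinear_apply (g : σ → MvPolynomial σ k) {i : ℕ} (c : PolyForm k σ i)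
    (v : Fin (i + 1) → σ → k) :
    wedgeLinear g c v =
      ∑ r : Fin (i + 1), (-1) ^ (r : ℕ) * ((∑ s, C (v r s) * g s) * c (r.removeNth v)) := by
  rw [wedgeLinear, AlternatingMap.alternatizeUncurryFin_apply]
  simp

theorem wedgeLinear_mem_polyDegree {g : σ → MvPolynomial σ k} {i : ℕ} {c : PolyForm k σ i}
    {d e : ℤ} (hg : ∀ s, g s ∈ polyDegree k σ e) (hc : ∀ v, c v ∈ polyDegree k σ d)
    (v : Fin (i + 1) → σ → k) : wedgeLinear g c v ∈ polyDegree k σ (e + d) := by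
  rw [wedgeLinear_apply]
  refine Submodule.sum_mem _ fun r _ => ?_
  have : (∑ s, C (v r s) * g s) * c (r.removeNth v) ∈ polyDegree k σ (e + d) := by
    refine mul_mem_polyDegree (Submodule.sum_mem _ fun s _ => ?_) (hc _)
    rw [C_mul']
    exact Submodule.smul_mem _ _ (hg s)
  rcases neg_one_pow_eq_or (MvPolynomial σ k) (r : ℕ) with h | h <;> rw [h]
  · rwa [one_mul]
  · rw [neg_one_mul]
    exact Submodule.neg_mem _ this

theorem wedgeLinear_mem_ideal {I : Ideal (MvPolynomial σ k)} {g : σ → MvPolynomial σ k} {i : ℕ}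
    {c : PolyForm k σ i} (hc : ∀ v, c v ∈ I) (v : Fin (i + 1) → σ → k) :
    wedgeLinear g c v ∈ I := by
  rw [wedgeLinear_apply]
  exact I.sum_mem fun r _ => I.mul_mem_left _ (I.mul_mem_left _ (hc _))

variable [DecidableEq σ]

/-- The connecting step of the long exact sequence of
`0 → S/(I ∩ J) → S/I ⊕ S/J → S/(I + J) → 0`. -/
theorem KoszulExactAt.inf {I J : Ideal (MvPolynomial σ k)} (hI : IsHomogeneousIdeal I)
    (hJ : IsHomogeneousIdeal J) {i : ℕ} {d : ℤ} (h₁ : KoszulExactAt I i d)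
    (h₂ : KoszulExactAt J i d) (h₃ : KoszulExactAt (I ⊔ J) (i + 1) (d - 1)) :
    KoszulExactAt (I ⊓ J) i d := by
  intro c hc hcyc
  obtain ⟨b₁, hb₁, hcb₁⟩ := h₁ c hc (hcyc.mono inf_le_left)
  obtain ⟨b₂, hb₂, hcb₂⟩ := h₂ c hc (hcyc.mono inf_le_right)
  obtain ⟨u, hu, hbu⟩ := h₃ (b₁ - b₂) (fun v => Submodule.sub_mem _ (hb₁ v) (hb₂ v)) (by
    intro v
    have : polyDifferential (b₁ - b₂) v =
        (c v - polyDifferential b₂ v) - (c v - polyDifferential b₁ v) := by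
      rw [polyDifferential_sub, AlternatingMap.sub_apply]
      ring
    rw [this]
    exact sub_mem (Submodule.mem_sup_right (hcb₂ v)) (Submodule.mem_sup_left (hcb₁ v)))
  have hu' (v) : polyDifferential u v ∈ polyDegree k σ (d - 1) := by
    have := polyDifferential_mem_polyDegree hu v
    rwa [sub_add_cancel] at this
  -- The class of `b₁ - b₂ - ∂u` modulo `I + J` vanishes, so it is a sum of forms in `I` and `J`.
  obtain ⟨pq, hpq, hpq'⟩ := exists_alternating_lift
    ((LinearMap.fst k (MvPolynomial σ k) (MvPolynomial σ k)) + LinearMap.snd k _ _)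
    ((I.restrictScalars k ⊓ polyDegree k σ (d - 1)).prod
      (J.restrictScalars k ⊓ polyDegree k σ (d - 1)))
    (b₁ - b₂ - polyDifferential u) (by
      intro v
      obtain ⟨p, hp, q, hq, hpd, hqd, e⟩ := exists_add_eq_of_mem_sup hI hJ (hbu v)
        (Submodule.sub_mem _ (Submodule.sub_mem _ (hb₁ v) (hb₂ v)) (hu' v))
      exact ⟨(p, q), ⟨⟨hp, hpd⟩, ⟨hq, hqd⟩⟩, e⟩)
  let p : PolyForm k σ (i + 1) := (LinearMap.fst k _ _).compAlternatingMap pq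
  let q : PolyForm k σ (i + 1) := (LinearMap.snd k _ _).compAlternatingMap pq
  have e : b₁ - polyDifferential u - p = b₂ + q := by
    ext1 v
    have : p v + q v = b₁ v - b₂ v - polyDifferential u v := hpq' v
    change b₁ v - polyDifferential u v - p v = b₂ v + q v
    linear_combination -this
  refine ⟨b₁ - polyDifferential u - p, fun v => ?_, fun v => ⟨?_, ?_⟩⟩
  · exact Submodule.sub_mem _ (Submodule.sub_mem _ (hb₁ v) (hu' v)) (hpq v).1.2
  · rw [polyDifferential_sub, polyDifferential_sub, polyDifferential_comp, sub_zero,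
      AlternatingMap.sub_apply, ← sub_add]
    exact I.add_mem (hcb₁ v) (polyDifferential_mem_ideal (fun v => (hpq v).1.1) v)
  · have e' : b₂ + q = b₂ - -q := by abel
    rw [e, e', polyDifferential_sub, AlternatingMap.sub_apply, ← sub_add]
    exact J.add_mem (hcb₂ v)
      (polyDifferential_mem_ideal (fun v => J.neg_mem (hpq v).2.1) v)

theorem wedgeLinear_cons (g : σ → MvPolynomial σ k) {i : ℕ} (c : PolyForm k σ i) (s : σ)
    (v : Fin i → σ → k) :
    wedgeLinear g c (Matrix.vecCons (Pi.single s 1) v) = g s * c v -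
      ∑ r : Fin i, (-1) ^ (r : ℕ) * ((∑ t, C (v r t) * g t) *
        c (r.succ.removeNth (Matrix.vecCons (Pi.single s 1) v))) := by
  rw [wedgeLinear_apply, Fin.sum_univ_succ, sub_eq_add_neg, ← Finset.sum_neg_distrib]
  congr 1
  · simp [Pi.single_apply]
  · refine Finset.sum_congr rfl fun r _ => ?_
    simp [pow_succ]

theorem polyDifferential_wedgeLinear_zero (g : σ → MvPolynomial σ k) (c : PolyForm k σ 0)
    (v : Fin 0 → σ → k) :
    polyDifferential (wedgeLinear g c) v = (∑ s, X s * g s) * c v := by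
  simp [polyDifferential_apply, wedgeLinear_cons, Finset.sum_mul, mul_assoc]

/-- The Koszul differential is an antiderivation. -/
theorem polyDifferential_wedgeLinear_succ (g : σ → MvPolynomial σ k) {i : ℕ}
    (c : PolyForm k σ (i + 1)) (v : Fin (i + 1) → σ → k) :
    polyDifferential (wedgeLinear g c) v =
      (∑ s, X s * g s) * c v - wedgeLinear g (polyDifferential c) v := by
  rw [polyDifferential_apply]
  simp only [wedgeLinear_cons, mul_sub, Finset.sum_sub_distrib]
  congr 1
  · simp [Finset.sum_mul, mul_assoc]
  · rw [wedgeLinear_apply]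
    simp only [Finset.mul_sum, polyDifferential_apply]
    rw [Finset.sum_comm]
    refine Finset.sum_congr rfl fun r _ => Finset.sum_congr rfl fun s _ => ?_
    have : r.succ.removeNth (Matrix.vecCons (Pi.single s (1 : k)) v) =
        Matrix.vecCons (Pi.single s 1) (r.removeNth v) := by
      funext j
      refine Fin.cases ?_ (fun j => ?_) j <;> simp [Fin.removeNth]
    rw [this]
    ring

/-- If `f = ∑ X_s g_s` is regular modulo `I`, the connecting map
`Tor_{i+1}(S/(I + f)) → Tor_i(S/I)` of the long exact sequence of multiplication by `f` is onto,
because `f` acts as zero on Koszul homology: `∂(g ∧ c) = f c` for a cycle `c`. -/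
theorem KoszulExactAt.of_sup_span {I : Ideal (MvPolynomial σ k)} (hI : IsHomogeneousIdeal I)
    {f : MvPolynomial σ k} {g : σ → MvPolynomial σ k} {e : ℤ} (hfg : f = ∑ s, X s * g s)
    (hg : ∀ s, g s ∈ polyDegree k σ e) (hreg : ∀ p, f * p ∈ I → p ∈ I) {i : ℕ} {d : ℤ}
    (h : KoszulExactAt (I ⊔ Ideal.span {f}) (i + 1) (e + d)) : KoszulExactAt I i d := by
  intro c hc hcyc
  have hf : f ∈ polyDegree k σ (1 + e) := by
    rw [hfg]
    exact Submodule.sum_mem _ fun s _ => mul_mem_polyDegree (X_mem_polyDegree s) (hg s)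
  have hw : ∀ v, f * c v - polyDifferential (wedgeLinear g c) v ∈ I := by
    intro v
    cases i with
    | zero =>
      rw [polyDifferential_wedgeLinear_zero, ← hfg, sub_self]
      exact I.zero_mem
    | succ i =>
      rw [polyDifferential_wedgeLinear_succ, ← hfg, sub_sub_cancel]
      exact wedgeLinear_mem_ideal hcyc v
  obtain ⟨u, hu, hwu⟩ := h (wedgeLinear g c) (wedgeLinear_mem_polyDegree hg hc) (by
    intro v
    have : polyDifferential (wedgeLinear g c) v =
      f * c v - (f * c v - polyDifferential (wedgeLinear g c) v) := by ring
    rw [this]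
    exact sub_mem (Submodule.mem_sup_right (Ideal.mul_mem_right _ _
      (Ideal.mem_span_singleton_self f))) (Submodule.mem_sup_left (hw v)))
  have hu' (v) : polyDifferential u v ∈ polyDegree k σ (e + d) := by
    have := polyDifferential_mem_polyDegree hu v
    rwa [sub_add_cancel] at this
  have hed : 1 + e + (d - 1) = e + d := by ring
  obtain ⟨ab, hab, hab'⟩ := exists_alternating_lift
    (LinearMap.fst k (MvPolynomial σ k) (MvPolynomial σ k) +
      LinearMap.mulLeft k f ∘ₗ LinearMap.snd k _ _)
    ((I.restrictScalars k).prod (polyDegree k σ (d - 1)))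
    (wedgeLinear g c - polyDifferential u) (by
      intro v
      obtain ⟨a, ha, b, -, hb, hab⟩ := exists_add_mul_eq_of_mem_sup_span (d := d - 1) hI hf
        (hwu v) (by
          rw [hed]
          exact Submodule.sub_mem _ (wedgeLinear_mem_polyDegree hg hc v) (hu' v))
      exact ⟨(a, b), ⟨ha, hb⟩, hab⟩)
  let a : PolyForm k σ (i + 1) := (LinearMap.fst k _ _).compAlternatingMap ab
  let b : PolyForm k σ (i + 1) := (LinearMap.snd k _ _).compAlternatingMap ab
  have e₁ : wedgeLinear g c - polyDifferential u - a = f • b := by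
    ext1 v
    have : a v + f * b v = wedgeLinear g c v - polyDifferential u v := hab' v
    change wedgeLinear g c v - polyDifferential u v - a v = f * b v
    linear_combination -this
  refine ⟨b, fun v => (hab v).2, fun v => hreg _ ?_⟩
  have e₂ : f * polyDifferential b v =
      polyDifferential (wedgeLinear g c) v - polyDifferential a v := by
    have h₁ : polyDifferential (f • b) v = f * polyDifferential b v := by
      simp [polyDifferential_apply, Finset.mul_sum, mul_left_comm]
    rw [← h₁, ← e₁, polyDifferential_sub, polyDifferential_sub, polyDifferential_comp, sub_zero,
      AlternatingMap.sub_apply]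
  rw [mul_sub, e₂, ← sub_add]
  exact I.add_mem (hw v) (polyDifferential_mem_ideal (fun v => (hab v).1) v)

/-- The bound `reg(S/I) ≤ r`. -/
def RegLE (I : Ideal (MvPolynomial σ k)) (r : ℤ) : Prop :=
  ∀ (i : ℕ) (d : ℤ), r < d → KoszulExactAt I i d

theorem RegLE.mono {I : Ideal (MvPolynomial σ k)} {r r' : ℤ} (h : RegLE I r) (hr : r ≤ r') :
    RegLE I r' :=
  fun i d hd => h i d (hr.trans_lt hd)

theorem RegLE.inf {I J : Ideal (MvPolynomial σ k)} (hI : IsHomogeneousIdeal I)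
    (hJ : IsHomogeneousIdeal J) {r r' : ℤ} (h₁ : RegLE I r) (h₂ : RegLE J r)
    (h₃ : RegLE (I ⊔ J) r') (hr : r' + 1 ≤ r) : RegLE (I ⊓ J) r :=
  fun i d hd => (h₁ i d hd).inf hI hJ (h₂ i d hd) (h₃ _ _ (by omega))

theorem RegLE.of_sup_span_X {I : Ideal (MvPolynomial σ k)} (hI : IsHomogeneousIdeal I) {s : σ}
    (hreg : ∀ p, X s * p ∈ I → p ∈ I) {r : ℤ} (h : RegLE (I ⊔ Ideal.span {X s}) r) :
    RegLE I r := by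
  intro i d hd
  refine KoszulExactAt.of_sup_span (g := Pi.single s 1) (e := 0) hI ?_ (fun t => ?_) hreg
    (h _ _ (by omega))
  · simp [Pi.single_apply]
  · rcases eq_or_ne t s with rfl | ht
    · rw [Pi.single_eq_same]
      exact isWeightedHomogeneous_one k _
    · rw [Pi.single_eq_of_ne ht]
      exact Submodule.zero_mem _

theorem regLE_of_forall_X_mem {I : Ideal (MvPolynomial σ k)} (h : ∀ s, X s ∈ I) : RegLE I 0 := by
  intro i d hd c hc _
  refine ⟨0, fun v => Submodule.zero_mem _, fun v => ?_⟩
  have h0 : polyDifferential (0 : PolyForm k σ (i + 1)) v = 0 := by simp [polyDifferential_apply]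
  rw [h0, sub_zero]
  have hle : Ideal.span (X '' Set.univ : Set (MvPolynomial σ k)) ≤ I := by
    rw [Ideal.span_le]
    rintro _ ⟨s, -, rfl⟩
    exact h s
  refine hle (mem_ideal_span_X_image.2 fun m hm => ?_)
  by_contra! hm'
  obtain rfl : m = 0 := Finsupp.ext fun s => hm' s trivial
  have := hc v (mem_support_iff.1 hm)
  simp at this
  omega

theorem regularity_le {I : Ideal (MvPolynomial σ k)} {r : ℤ} (hr : 0 ≤ r) (h : RegLE I r) :
    regularity I ≤ r := by
  unfold regularity
  rcases Set.eq_empty_or_nonempty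
    {r : ℤ | ∃ i j : ℕ, gradedBetti I i j ≠ 0 ∧ r = (j : ℤ) - i} with h0 | h0
  -- The supremum of the empty set of integers is `0`.
  · rw [h0]
    simpa using hr
  · refine csSup_le h0 ?_
    rintro _ ⟨i, j, hij, rfl⟩
    by_contra! hlt
    exact hij ((gradedBetti_eq_zero_iff I i j).2 (h i _ hlt))

theorem le_regularity {I : Ideal (MvPolynomial σ k)} {r : ℤ} (h : RegLE I r) {i j : ℕ}
    (hij : ¬ KoszulExactAt I i ((j : ℤ) - i)) : (j : ℤ) - i ≤ regularity I := by
  refine le_csSup ⟨r, ?_⟩ ⟨i, j, fun h0 => hij ((gradedBetti_eq_zero_iff I i j).1 h0), rfl⟩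
  rintro _ ⟨i, j, hij, rfl⟩
  by_contra! hlt
  exact hij ((gradedBetti_eq_zero_iff I i j).2 (h i _ hlt))

end RegularityBounds

/-! ### Setting variables to zero or one, and regular variables -/

section VariableSubstitutions

variable {k : Type*} [Field k] {σ : Type*}

/-- The ideal `L` is generated by polynomials in which no variable from `W` occurs. -/
def IsFreeOf (W : Set σ) (L : Ideal (MvPolynomial σ k)) : Prop :=
  ∃ T ⊆ (supported k Wᶜ : Set (MvPolynomial σ k)), L = Ideal.span T

theorem IsFreeOf.mono {W W' : Set σ} {L : Ideal (MvPolynomial σ k)} (h : IsFreeOf W L)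
    (hW : W' ⊆ W) : IsFreeOf W' L := by
  obtain ⟨T, hT, rfl⟩ := h
  exact ⟨T, hT.trans (supported_mono (Set.compl_subset_compl.2 hW)), rfl⟩

theorem IsFreeOf.sup {W : Set σ} {L L' : Ideal (MvPolynomial σ k)} (h : IsFreeOf W L)
    (h' : IsFreeOf W L') : IsFreeOf W (L ⊔ L') := by
  obtain ⟨T, hT, rfl⟩ := h
  obtain ⟨T', hT', rfl⟩ := h'
  exact ⟨T ∪ T', Set.union_subset hT hT', (Ideal.span_union T T').symm⟩

theorem isFreeOf_bot (W : Set σ) : IsFreeOf W (⊥ : Ideal (MvPolynomial σ k)) :=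
  ⟨∅, Set.empty_subset _, Ideal.span_empty.symm⟩

theorem isFreeOf_span_X {W Z : Set σ} (h : Disjoint W Z) :
    IsFreeOf W (Ideal.span (X '' Z : Set (MvPolynomial σ k))) := by
  refine ⟨_, ?_, rfl⟩
  rintro _ ⟨s, hs, rfl⟩
  exact X_mem_supported.2 fun hW => Set.disjoint_left.1 h hW hs

theorem algHom_eq_self_of_mem_supported {W : Set σ} {φ : MvPolynomial σ k →ₐ[k] MvPolynomial σ k}
    (hφ : ∀ s ∉ W, φ (X s) = X s) {p : MvPolynomial σ k} (hp : p ∈ supported k Wᶜ) : φ p = p := by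
  have h : supported k Wᶜ ≤ AlgHom.equalizer φ (AlgHom.id k _) := by
    rw [supported, Algebra.adjoin_le_iff]
    rintro _ ⟨s, hs, rfl⟩
    exact hφ s hs
  exact h hp

theorem IsFreeOf.algHom_mem {W : Set σ} {L : Ideal (MvPolynomial σ k)} (hL : IsFreeOf W L)
    {φ : MvPolynomial σ k →ₐ[k] MvPolynomial σ k} (hφ : ∀ s ∉ W, φ (X s) = X s)
    {p : MvPolynomial σ k} (hp : p ∈ L) : φ p ∈ L := by
  obtain ⟨T, hT, rfl⟩ := hL
  have h : Ideal.span T ≤ (Ideal.span T).comap φ := by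
    rw [Ideal.span_le]
    intro t ht
    change φ t ∈ Ideal.span T
    rw [algHom_eq_self_of_mem_supported hφ (hT ht)]
    exact Ideal.subset_span ht
  exact h hp

theorem IsFreeOf.isWeightedHomogeneousIdeal {M : Type*} [AddCommMonoid M] {W : Set σ}
    {L : Ideal (MvPolynomial σ k)} (hL : IsFreeOf W L) {w : σ → M} (hw : ∀ s ∉ W, w s = 0) :
    IsWeightedHomogeneousIdeal w L := by
  obtain ⟨T, hT, rfl⟩ := hL
  refine isWeightedHomogeneousIdeal_span w fun f hf => ⟨0, fun d hd => ?_⟩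
  have hv := mem_supported.1 (hT hf)
  rw [Finsupp.weight_apply]
  refine Finset.sum_eq_zero fun s hs => ?_
  have h0 : w s = 0 := hw s (hv ((mem_vars_iff_mem_support s).2 ⟨d, mem_support_iff.2 hd, hs⟩))
  simp only [h0, smul_zero]

open Classical in
/-- The substitution setting the variables in `W` to zero. -/
noncomputable def setZero (k : Type*) [Field k] (W : Set σ) :
    MvPolynomial σ k →ₐ[k] MvPolynomial σ k :=
  aeval fun s => if s ∈ W then 0 else X s

theorem setZero_X_of_mem {W : Set σ} {s : σ} (hs : s ∈ W) : setZero k W (X s) = 0 := by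
  simp [setZero, hs]

theorem setZero_X_of_notMem {W : Set σ} {s : σ} (hs : s ∉ W) : setZero k W (X s) = X s := by
  simp [setZero, hs]

theorem sub_setZero_mem (W : Set σ) (p : MvPolynomial σ k) :
    p - setZero k W p ∈ Ideal.span (X '' W : Set (MvPolynomial σ k)) := by
  rw [← Ideal.Quotient.eq]
  have : (Ideal.Quotient.mkₐ k (Ideal.span (X '' W : Set (MvPolynomial σ k)))) =
      (Ideal.Quotient.mkₐ k _).comp (setZero k W) := by
    refine MvPolynomial.algHom_ext fun s => ?_
    by_cases hs : s ∈ W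
    · rw [AlgHom.comp_apply, setZero_X_of_mem hs, map_zero]
      exact Ideal.Quotient.eq_zero_iff_mem.2 (Ideal.subset_span ⟨s, hs, rfl⟩)
    · rw [AlgHom.comp_apply, setZero_X_of_notMem hs]
  exact AlgHom.congr_fun this p

open Classical in
/-- The substitution setting the variables in `W` to one. -/
noncomputable def setOne (k : Type*) [Field k] (W : Set σ) :
    MvPolynomial σ k →ₐ[k] MvPolynomial σ k :=
  aeval fun s => if s ∈ W then 1 else X s

theorem setOne_X_of_mem {W : Set σ} {s : σ} (hs : s ∈ W) : setOne k W (X s) = 1 := by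
  simp [setOne, hs]

theorem setOne_X_of_notMem {W : Set σ} {s : σ} (hs : s ∉ W) : setOne k W (X s) = X s := by
  simp [setOne, hs]

open Classical in
theorem setOne_monomial (W : Set σ) (d : σ →₀ ℕ) (a : k) :
    setOne k W (monomial d a) = monomial (d.filter (· ∉ W)) a := by
  rw [setOne, aeval_monomial, monomial_eq, algebraMap_eq]
  congr 1
  rw [Finsupp.prod_filter_index, Finsupp.prod, Finsupp.support_filter, Finset.prod_filter]
  refine Finset.prod_congr rfl fun s _ => ?_
  by_cases hs : s ∈ W <;> simp [hs]

/-- If, modulo a `w`-homogeneous ideal `I`, all monomials of the same weight in the variables from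
`W` agree and `I` is stable under setting these variables to `1`, then each of them is regular
modulo `I`: a `w`-homogeneous polynomial is congruent to the product of its value at `1` and a
monomial in the variables from `W`. -/
theorem mem_of_X_mul_mem {M : Type*} [AddCommMonoid M] [IsCancelAdd M] {w : σ → M} {W : Set σ}
    (hw : ∀ s ∉ W, w s = 0) {I : Ideal (MvPolynomial σ k)} (hI : IsWeightedHomogeneousIdeal w I)
    (hone : ∀ f ∈ I, setOne k W f ∈ I)
    (hmon : ∀ m m' : σ →₀ ℕ, ↑m.support ⊆ W → ↑m'.support ⊆ W →
      Finsupp.weight w m = Finsupp.weight w m' → monomial m (1 : k) - monomial m' 1 ∈ I)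
    {s : σ} (hs : s ∈ W) {p : MvPolynomial σ k} (hp : X s * p ∈ I) : p ∈ I := by
  classical
  have hweight (d : σ →₀ ℕ) : Finsupp.weight w (d.filter (· ∈ W)) = Finsupp.weight w d := by
    conv_rhs => rw [← Finsupp.filter_add_filter_not d (· ∈ W), map_add]
    have : Finsupp.weight w (d.filter (· ∉ W)) = 0 := by
      rw [Finsupp.weight_apply]
      refine Finset.sum_eq_zero fun t ht => ?_
      rw [Finsupp.support_filter, Finset.mem_filter] at ht
      simp only [hw t ht.2, smul_zero]
    rw [this, add_zero]
  have hsupp (d : σ →₀ ℕ) : (↑(d.filter (· ∈ W)).support : Set σ) ⊆ W := by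
    intro t ht
    rw [Finset.mem_coe, Finsupp.support_filter, Finset.mem_filter] at ht
    exact ht.2
  have key (f : MvPolynomial σ k) (e : M) (hf : IsWeightedHomogeneous w f e)
      (h1 : setOne k W f ∈ I) : f ∈ I := by
    rcases eq_or_ne f 0 with rfl | h0
    · exact I.zero_mem
    obtain ⟨d₀, hd₀⟩ := MvPolynomial.ne_zero_iff.1 h0
    have h2 : f - setOne k W f * monomial (d₀.filter (· ∈ W)) 1 ∈ I := by
      conv =>
        enter [2]
        rw [f.as_sum]
      rw [map_sum, Finset.sum_mul, ← Finset.sum_sub_distrib]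
      refine I.sum_mem fun d hd => ?_
      have h3 : monomial d (coeff d f) =
          monomial (d.filter (· ∉ W)) (coeff d f) * monomial (d.filter (· ∈ W)) 1 := by
        rw [monomial_mul, mul_one, add_comm, Finsupp.filter_add_filter_not]
      rw [setOne_monomial, h3, ← mul_sub]
      refine I.mul_mem_left _ (hmon _ _ (hsupp _) (hsupp _) ?_)
      rw [hweight, hweight, hf (mem_support_iff.1 hd), hf hd₀]
    simpa using I.add_mem h2 (I.mul_mem_right (monomial (d₀.filter (· ∈ W)) 1) h1)
  rw [← sum_weightedHomogeneousComponent w p]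
  refine finsum_induction (· ∈ I) I.zero_mem (fun _ _ => I.add_mem) fun e => ?_
  refine key _ e (weightedHomogeneousComponent_isWeightedHomogeneous e p) ?_
  have h4 := hone _ (hI _ hp (w s + e))
  rwa [weightedHomogeneousComponent_mul_left (isWeightedHomogeneous_X k w s), map_mul,
    setOne_X_of_mem hs, one_mul] at h4

/-- A variable is regular modulo an ideal that does not involve it. -/
theorem IsFreeOf.mem_of_X_mul_mem {s : σ} {I : Ideal (MvPolynomial σ k)} (hI : IsFreeOf {s} I)
    {p : MvPolynomial σ k} (hp : X s * p ∈ I) : p ∈ I := by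
  classical
  have hw : ∀ t ∉ ({s} : Set σ), (Pi.single s 1 : σ → ℕ) t = 0 := fun t ht =>
    Pi.single_eq_of_ne ht 1
  refine _root_.mem_of_X_mul_mem hw (hI.isWeightedHomogeneousIdeal hw)
    (fun f hf => hI.algHom_mem (fun t ht => setOne_X_of_notMem ht) hf) ?_ rfl hp
  intro m m' hm hm' h
  have hval (m : σ →₀ ℕ) : Finsupp.weight (Pi.single s 1 : σ → ℕ) m = m s := by
    rw [Finsupp.weight_apply, Finsupp.sum]
    simp only [Pi.single_apply, smul_eq_mul, mul_ite, mul_one, mul_zero,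
      Finset.sum_ite_eq', Finsupp.mem_support_iff]
    split_ifs <;> simp_all
  have : m = m' := by
    ext t
    by_cases ht : t = s
    · subst ht
      rw [← hval, h, hval]
    · rw [Finsupp.notMem_support_iff.1 fun h => ht (hm h),
        Finsupp.notMem_support_iff.1 fun h => ht (hm' h)]
  rw [this, sub_self]
  exact I.zero_mem

end VariableSubstitutions

/-! ### Edge ideals with additional relations -/

section EdgeIdeals

variable {k : Type*} [Field k] {V : Type*}

/-- The variables `x_v`, `y_v` attached to the vertices `v ∈ U`. -/
def vertexVars (U : Set V) : Set (V ⊕ V) :=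
  {s | Sum.elim id id s ∈ U}

@[simp]
theorem inl_mem_vertexVars {U : Set V} {v : V} : Sum.inl v ∈ vertexVars U ↔ v ∈ U := Iff.rfl

@[simp]
theorem inr_mem_vertexVars {U : Set V} {v : V} : Sum.inr v ∈ vertexVars U ↔ v ∈ U := Iff.rfl

theorem vertexVars_mono {U U' : Set V} (h : U ⊆ U') : vertexVars U ⊆ vertexVars U' :=
  fun _ hs => h hs

theorem vertexVars_union (U U' : Set V) :
    vertexVars (U ∪ U') = vertexVars U ∪ vertexVars U' := rfl

theorem disjoint_vertexVars {U U' : Set V} (h : Disjoint U U') :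
    Disjoint (vertexVars U) (vertexVars U') :=
  Set.disjoint_left.2 fun _ hs hs' => Set.disjoint_left.1 h hs hs'

/-- The ideal generated by the variables in `Z`. -/
noncomputable def varIdeal (k : Type*) [Field k] {σ : Type*} (Z : Set σ) :
    Ideal (MvPolynomial σ k) :=
  Ideal.span (X '' Z)

theorem X_mem_varIdeal {σ : Type*} {Z : Set σ} {s : σ} (hs : s ∈ Z) : X s ∈ varIdeal k Z :=
  Ideal.subset_span ⟨s, hs, rfl⟩

theorem varIdeal_le {σ : Type*} {Z : Set σ} {I : Ideal (MvPolynomial σ k)} :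
    varIdeal k Z ≤ I ↔ ∀ s ∈ Z, X s ∈ I := by
  rw [varIdeal, Ideal.span_le]
  exact ⟨fun h s hs => h ⟨s, hs, rfl⟩, by rintro h _ ⟨s, hs, rfl⟩; exact h s hs⟩

theorem varIdeal_union {σ : Type*} (Z Z' : Set σ) :
    varIdeal k (Z ∪ Z') = varIdeal k Z ⊔ varIdeal k Z' := by
  rw [varIdeal, Set.image_union, Ideal.span_union]
  rfl

theorem isHomogeneousIdeal_varIdeal {σ : Type*} (Z : Set σ) :
    IsHomogeneousIdeal (varIdeal k Z) := by
  refine isWeightedHomogeneousIdeal_span _ ?_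
  rintro _ ⟨s, -, rfl⟩
  exact ⟨1, X_mem_polyDegree s⟩

/-- The binomial `x_v y_w - y_v x_w`. -/
noncomputable def edgeBinomial (k : Type*) [Field k] {V : Type*} (v w : V) :
    MvPolynomial (V ⊕ V) k :=
  X (Sum.inl v) * X (Sum.inr w) - X (Sum.inr v) * X (Sum.inl w)

theorem edgeBinomial_swap (v w : V) : edgeBinomial k w v = -edgeBinomial k v w := by
  unfold edgeBinomial
  ring

theorem edgeBinomial_mem_polyDegree (v w : V) : edgeBinomial k v w ∈ polyDegree k (V ⊕ V) 2 :=
  Submodule.sub_mem _ (mul_mem_polyDegree (X_mem_polyDegree _) (X_mem_polyDegree _))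
    (mul_mem_polyDegree (X_mem_polyDegree _) (X_mem_polyDegree _))

theorem edgeBinomial_mem_of_left {I : Ideal (MvPolynomial (V ⊕ V) k)} {v w : V}
    (hx : X (Sum.inl v) ∈ I) (hy : X (Sum.inr v) ∈ I) : edgeBinomial k v w ∈ I :=
  I.sub_mem (I.mul_mem_right _ hx) (I.mul_mem_right _ hy)

theorem edgeBinomial_mem_of_right {I : Ideal (MvPolynomial (V ⊕ V) k)} {v w : V}
    (hx : X (Sum.inl w) ∈ I) (hy : X (Sum.inr w) ∈ I) : edgeBinomial k v w ∈ I :=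
  I.sub_mem (I.mul_mem_left _ hy) (I.mul_mem_left _ hx)

theorem setZero_edgeBinomial_of_notMem {W : Set (V ⊕ V)} {v w : V} (h₁ : Sum.inl v ∉ W)
    (h₂ : Sum.inr v ∉ W) (h₃ : Sum.inl w ∉ W) (h₄ : Sum.inr w ∉ W) :
    setZero k W (edgeBinomial k v w) = edgeBinomial k v w := by
  simp only [edgeBinomial, map_sub, map_mul, setZero_X_of_notMem h₁, setZero_X_of_notMem h₂,
    setZero_X_of_notMem h₃, setZero_X_of_notMem h₄]

theorem setZero_edgeBinomial_of_left_mem {W : Set (V ⊕ V)} {v w : V} (h₁ : Sum.inl v ∈ W)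
    (h₂ : Sum.inr v ∈ W) : setZero k W (edgeBinomial k v w) = 0 := by
  simp only [edgeBinomial, map_sub, map_mul, setZero_X_of_mem h₁, setZero_X_of_mem h₂, zero_mul,
    sub_zero]

theorem setZero_edgeBinomial_of_right_mem {W : Set (V ⊕ V)} {v w : V} (h₁ : Sum.inl w ∈ W)
    (h₂ : Sum.inr w ∈ W) : setZero k W (edgeBinomial k v w) = 0 := by
  rw [edgeBinomial_swap, map_neg, setZero_edgeBinomial_of_left_mem h₁ h₂, neg_zero]

/-- The ideal generated by the binomials of the edges of `G` with both ends in `U`. -/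
noncomputable def inducedEdgeIdeal (k : Type*) [Field k] {V : Type*} (G : SimpleGraph V)
    (U : Set V) : Ideal (MvPolynomial (V ⊕ V) k) :=
  Ideal.span {p | ∃ v ∈ U, ∃ w ∈ U, G.Adj v w ∧ p = edgeBinomial k v w}

variable {G : SimpleGraph V} {U U₁ U₂ : Set V} {L : Ideal (MvPolynomial (V ⊕ V) k)}

theorem edgeBinomial_mem_inducedEdgeIdeal {v w : V} (hv : v ∈ U) (hw : w ∈ U) (h : G.Adj v w) :
    edgeBinomial k v w ∈ inducedEdgeIdeal k G U :=
  Ideal.subset_span ⟨v, hv, w, hw, h, rfl⟩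

theorem inducedEdgeIdeal_le {I : Ideal (MvPolynomial (V ⊕ V) k)} :
    inducedEdgeIdeal k G U ≤ I ↔ ∀ v ∈ U, ∀ w ∈ U, G.Adj v w → edgeBinomial k v w ∈ I := by
  rw [inducedEdgeIdeal, Ideal.span_le]
  constructor
  · exact fun h v hv w hw hvw => h ⟨v, hv, w, hw, hvw, rfl⟩
  · rintro h _ ⟨v, hv, w, hw, hvw, rfl⟩
    exact h v hv w hw hvw

theorem binomialEdgeIdeal_eq : binomialEdgeIdeal k G = inducedEdgeIdeal k G Set.univ := by
  simp only [binomialEdgeIdeal, inducedEdgeIdeal, edgeBinomial, Set.mem_univ, true_and]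

theorem isHomogeneousIdeal_inducedEdgeIdeal (G : SimpleGraph V) (U : Set V) :
    IsHomogeneousIdeal (inducedEdgeIdeal k G U) := by
  refine isWeightedHomogeneousIdeal_span _ ?_
  rintro _ ⟨v, -, w, -, -, rfl⟩
  exact ⟨2, edgeBinomial_mem_polyDegree v w⟩

theorem edgeBinomial_mem_supported {W : Set (V ⊕ V)} {v w : V} (h₁ : Sum.inl v ∈ W)
    (h₂ : Sum.inr v ∈ W) (h₃ : Sum.inl w ∈ W) (h₄ : Sum.inr w ∈ W) :
    edgeBinomial k v w ∈ supported k W :=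
  sub_mem (mul_mem (X_mem_supported.2 h₁) (X_mem_supported.2 h₄))
    (mul_mem (X_mem_supported.2 h₂) (X_mem_supported.2 h₃))

theorem isFreeOf_inducedEdgeIdeal (h : Disjoint U₁ U₂) :
    IsFreeOf (vertexVars U₁) (inducedEdgeIdeal k G U₂) := by
  refine ⟨_, ?_, rfl⟩
  rintro _ ⟨v, hv, w, hw, -, rfl⟩
  have hv' := Set.disjoint_right.1 h hv
  have hw' := Set.disjoint_right.1 h hw
  exact edgeBinomial_mem_supported hv' hv' hw' hw'


/-- Killing variables that do not occur in `L` does not lower the regularity. -/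
theorem RegLE.of_varIdeal_sup {σ : Type*} [Fintype σ] [DecidableEq σ] {r : ℤ} (Y : Finset σ) :
    ∀ {L : Ideal (MvPolynomial σ k)}, IsFreeOf (Y : Set σ) L → IsHomogeneousIdeal L →
      RegLE (varIdeal k (Y : Set σ) ⊔ L) r → RegLE L r := by
  induction Y using Finset.induction_on with
  | empty =>
    intro L _ _ h
    simpa [varIdeal] using h
  | insert s Y hs ih =>
    intro L hL hLh h
    have hX : Ideal.span {X s} = varIdeal k {s} := by simp [varIdeal]
    refine RegLE.of_sup_span_X (s := s) hLh
      (fun p hp => (hL.mono (by simp)).mem_of_X_mul_mem hp) ?_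
    rw [hX]
    refine ih ((hL.mono (by simp)).sup (isFreeOf_span_X (by simpa using hs)))
      (hLh.sup (isHomogeneousIdeal_varIdeal _)) ?_
    rw [Finset.coe_insert, Set.insert_eq, varIdeal_union] at h
    rwa [sup_comm L, ← sup_assoc, sup_comm (varIdeal k _)]

end EdgeIdeals

/-! ### Complete graphs -/

section CompleteGraphs

variable {k : Type*} [Field k] {V : Type*}

/-- The weights of the torus action on the coordinate ring of the Segre embedding:
`x_v` and `y_v` have weight `e_v` in the first factor, and the second one counts the `x_v`. -/
def segreWeight (V : Type*) [DecidableEq V] : V ⊕ V → (V → ℕ) × ℕ :=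
  Sum.elim (fun v => (Pi.single v 1, 1)) (fun v => (Pi.single v 1, 0))

/-- Killing `x_n` in the edge ideal of a complete component splits it as an intersection. -/
theorem completeEdgeIdeal_sup_X_eq_inf {n : V} {U : Set V} (hn : n ∉ U)
    {L : Ideal (MvPolynomial (V ⊕ V) k)} (hL : IsFreeOf (vertexVars (insert n U)) L) :
    inducedEdgeIdeal k ⊤ (insert n U) ⊔ L ⊔ Ideal.span {X (Sum.inl n)} =
      (inducedEdgeIdeal k ⊤ U ⊔ (varIdeal k (vertexVars {n}) ⊔ L)) ⊓
        (varIdeal k (Sum.inl '' insert n U) ⊔ L) := by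
  set T := inducedEdgeIdeal k ⊤ (insert n U) ⊔ L ⊔ Ideal.span {X (Sum.inl n)} with hT
  have hTn : X (Sum.inl n) ∈ T := Submodule.mem_sup_right (Ideal.mem_span_singleton_self _)
  have hTL : L ≤ T := le_sup_right.trans le_sup_left
  have hTe : inducedEdgeIdeal k ⊤ (insert n U) ≤ T := le_sup_left.trans le_sup_left
  have hZ : Sum.inl '' insert n U ⊆ vertexVars (insert n U) := by
    rintro _ ⟨v, hv, rfl⟩
    exact hv
  have hY : {Sum.inr n} ⊆ vertexVars (insert n U) := by
    rintro _ rfl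
    exact Set.mem_insert n U
  apply le_antisymm
  · refine le_inf (sup_le (sup_le (inducedEdgeIdeal_le.2 fun v hv w hw hvw => ?_) ?_) ?_)
      (sup_le (sup_le (inducedEdgeIdeal_le.2 fun v hv w hw _ => ?_) le_sup_right) ?_)
    · have hleft {s} (hs : s ∈ vertexVars {n}) : X s ∈
          inducedEdgeIdeal k ⊤ U ⊔ (varIdeal k (vertexVars {n}) ⊔ L) :=
        Submodule.mem_sup_right (Submodule.mem_sup_left (X_mem_varIdeal hs))
      rcases hv with rfl | hv
      · exact edgeBinomial_mem_of_left (hleft rfl) (hleft rfl)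
      rcases hw with rfl | hw
      · exact edgeBinomial_mem_of_right (hleft rfl) (hleft rfl)
      exact Submodule.mem_sup_left (edgeBinomial_mem_inducedEdgeIdeal hv hw hvw)
    · exact le_sup_right.trans le_sup_right
    · rw [Ideal.span_singleton_le_iff_mem]
      exact Submodule.mem_sup_right (Submodule.mem_sup_left (X_mem_varIdeal rfl))
    · exact Submodule.mem_sup_left (Ideal.sub_mem _
        (Ideal.mul_mem_right _ _ (X_mem_varIdeal ⟨v, hv, rfl⟩))
        (Ideal.mul_mem_left _ _ (X_mem_varIdeal ⟨w, hw, rfl⟩)))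
    · rw [Ideal.span_singleton_le_iff_mem]
      exact Submodule.mem_sup_left (X_mem_varIdeal ⟨n, Set.mem_insert n U, rfl⟩)
  · rintro f ⟨hf₁, hf₂⟩
    let π := setZero k (Sum.inl '' insert n U : Set (V ⊕ V))
    let κ := setZero k ({Sum.inr n} : Set (V ⊕ V))
    have hπL (p) (hp : p ∈ L) : π p ∈ L :=
      (hL.mono hZ).algHom_mem (fun s hs => setZero_X_of_notMem hs) hp
    have hκL (p) (hp : p ∈ L) : κ p ∈ L :=
      (hL.mono hY).algHom_mem (fun s hs => setZero_X_of_notMem hs) hp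
    have hπ : π f ∈ L := by
      have : varIdeal k (Sum.inl '' insert n U) ⊔ L ≤ L.comap π := by
        refine sup_le (varIdeal_le.2 fun s hs => ?_) fun p hp => Ideal.mem_comap.2 (hπL p hp)
        rw [Ideal.mem_comap, setZero_X_of_mem hs]
        exact L.zero_mem
      exact Ideal.mem_comap.1 (this hf₂)
    have hκ : κ f ∈ T := by
      have : inducedEdgeIdeal k ⊤ U ⊔ (varIdeal k (vertexVars {n}) ⊔ L) ≤ T.comap κ := by
        refine sup_le (inducedEdgeIdeal_le.2 fun v hv w hw hvw => ?_)
          (sup_le (varIdeal_le.2 fun s hs => ?_) fun p hp => Ideal.mem_comap.2 (hTL (hκL p hp)))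
        · have hv' : v ≠ n := fun h => hn (h ▸ hv)
          have hw' : w ≠ n := fun h => hn (h ▸ hw)
          rw [Ideal.mem_comap, setZero_edgeBinomial_of_notMem (by simp) (by simpa using hv')
            (by simp) (by simpa using hw')]
          exact hTe (edgeBinomial_mem_inducedEdgeIdeal (Set.mem_insert_of_mem n hv)
            (Set.mem_insert_of_mem n hw) hvw)
        · rcases s with s | s
          · obtain rfl : s = n := hs
            rw [Ideal.mem_comap, setZero_X_of_notMem (by simp)]
            exact hTn
          · obtain rfl : s = n := hs
            rw [Ideal.mem_comap, setZero_X_of_mem (by simp)]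
            exact T.zero_mem
      exact Ideal.mem_comap.1 (this hf₁)
    -- Terms divisible by some `x_v` and by `y_n` lie in `T`, since `x_v y_n ∈ T`.
    have hxy (v : V) (hv : v ∈ insert n U) : X (Sum.inr n) * X (Sum.inl v) ∈ T := by
      rcases eq_or_ne v n with rfl | hvn
      · exact T.mul_mem_left _ hTn
      · have e : (X (Sum.inr n) * X (Sum.inl v) : MvPolynomial (V ⊕ V) k) =
            edgeBinomial k v n + X (Sum.inr v) * X (Sum.inl n) := by
          unfold edgeBinomial
          ring
        rw [e]
        exact T.add_mem (hTe (edgeBinomial_mem_inducedEdgeIdeal hv (Set.mem_insert n U) hvn))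
          (T.mul_mem_left _ hTn)
    have hdiff : ∀ h ∈ varIdeal k (Sum.inl '' insert n U : Set (V ⊕ V)),
        ∀ a, a * h - κ (a * h) ∈ T := by
      intro h hh
      induction hh using Submodule.span_induction with
      | mem x hx =>
        obtain ⟨_, ⟨v, hv, rfl⟩, rfl⟩ := hx
        intro a
        have h1 : κ (X (Sum.inl v)) = X (Sum.inl v) := setZero_X_of_notMem (by simp)
        rw [map_mul, h1, ← sub_mul]
        have h2 := sub_setZero_mem (k := k) {Sum.inr n} a
        rw [Set.image_singleton] at h2
        obtain ⟨b, hb⟩ := Ideal.mem_span_singleton'.1 h2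
        rw [← hb, mul_assoc]
        exact T.mul_mem_left _ (hxy v hv)
      | zero => simp
      | add x y _ _ hx hy =>
        intro a
        have e : a * (x + y) - κ (a * (x + y)) =
            (a * x - κ (a * x)) + (a * y - κ (a * y)) := by
          rw [mul_add, map_add]
          ring
        rw [e]
        exact T.add_mem (hx a) (hy a)
      | smul b x _ hx =>
        intro a
        rw [smul_eq_mul, ← mul_assoc]
        exact hx _
    have h1 := hdiff (f - π f) (sub_setZero_mem _ f) 1
    rw [one_mul, map_sub] at h1
    have e : f = (f - π f - (κ f - κ (π f))) + π f + κ f - κ (π f) := by ring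
    rw [e]
    exact T.sub_mem (T.add_mem (T.add_mem h1 (hTL hπ)) hκ) (hTL (hκL _ hπ))

variable [Fintype V] [DecidableEq V]

theorem weight_segreWeight_fst (m : V ⊕ V →₀ ℕ) (v : V) :
    (Finsupp.weight (segreWeight V) m).1 v = m (Sum.inl v) + m (Sum.inr v) := by
  rw [Finsupp.weight_apply, Finsupp.sum_fintype _ _ (by simp), Fintype.sum_sum_type]
  simp [segreWeight, Prod.fst_sum, Finset.sum_apply, Pi.single_apply]

theorem weight_segreWeight_snd (m : V ⊕ V →₀ ℕ) :
    (Finsupp.weight (segreWeight V) m).2 = ∑ v, m (Sum.inl v) := by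
  rw [Finsupp.weight_apply, Finsupp.sum_fintype _ _ (by simp), Fintype.sum_sum_type]
  simp [segreWeight, Prod.snd_sum]

theorem weight_add_single {σ M : Type*} [AddCommMonoid M] (w : σ → M) (m : σ →₀ ℕ) (s : σ) :
    Finsupp.weight w (m + Finsupp.single s 1) = Finsupp.weight w m + w s := by
  rw [map_add, Finsupp.weight_single, one_smul]

/-- Monomials of the same Segre weight are congruent modulo the `2 × 2` minors. -/
theorem monomial_sub_monomial_mem (U : Set V) (n : ℕ) :
    ∀ m m' : V ⊕ V →₀ ℕ, (∑ v, m (Sum.inl v) = n) → ↑m.support ⊆ vertexVars U →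
      ↑m'.support ⊆ vertexVars U →
      Finsupp.weight (segreWeight V) m = Finsupp.weight (segreWeight V) m' →
      monomial m (1 : k) - monomial m' 1 ∈ inducedEdgeIdeal k ⊤ U := by
  induction n with
  | zero =>
    intro m m' hn _ _ h
    have h2 : ∑ v, m' (Sum.inl v) = 0 := by
      rw [← weight_segreWeight_snd, ← h, weight_segreWeight_snd, hn]
    have : m = m' := by
      ext s
      have hl (v : V) : m (Sum.inl v) = 0 := by simpa using Finset.sum_eq_zero_iff.1 hn v
      have hl' (v : V) : m' (Sum.inl v) = 0 := by simpa using Finset.sum_eq_zero_iff.1 h2 v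
      rcases s with v | v
      · rw [hl, hl']
      · have := congrFun (congrArg Prod.fst h) v
        rw [weight_segreWeight_fst, weight_segreWeight_fst, hl, hl', zero_add, zero_add] at this
        exact this
    rw [this, sub_self]
    exact Ideal.zero_mem _
  | succ n ih =>
    intro m m' hn hm hm' h
    obtain ⟨v, hv⟩ : ∃ v, m (Sum.inl v) ≠ 0 := by
      by_contra! h0
      simp [h0] at hn
    have hvU : v ∈ U := hm (Finsupp.mem_support_iff.2 hv)
    obtain ⟨m₁, rfl⟩ : ∃ m₁, m = m₁ + Finsupp.single (Sum.inl v) 1 :=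
      ⟨m - Finsupp.single (Sum.inl v) 1, (tsub_add_cancel_of_le (by
        simpa using Nat.one_le_iff_ne_zero.2 hv)).symm⟩
    have hn₁ : ∑ v, m₁ (Sum.inl v) = n := by
      simp only [Finsupp.add_apply, Finset.sum_add_distrib] at hn
      simpa [Finsupp.single_apply] using hn
    have hm₁ : ↑m₁.support ⊆ vertexVars U := fun s hs => hm (by
      rw [Finset.mem_coe, Finsupp.mem_support_iff] at hs ⊢
      simp [hs])
    -- It suffices to replace `m'` by a congruent monomial that involves `x_v`.
    suffices H : ∃ m₂ : V ⊕ V →₀ ℕ, ↑m₂.support ⊆ vertexVars U ∧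
        Finsupp.weight (segreWeight V) (m₂ + Finsupp.single (Sum.inl v) 1) =
          Finsupp.weight (segreWeight V) m' ∧
        monomial (m₂ + Finsupp.single (Sum.inl v) 1) (1 : k) - monomial m' 1 ∈
          inducedEdgeIdeal k ⊤ U by
      obtain ⟨m₂, hm₂, hw, hmem⟩ := H
      have h₁ := ih m₁ m₂ hn₁ hm₁ hm₂ (by
        rw [← hw, weight_add_single, weight_add_single] at h
        exact add_right_cancel h)
      have h₂ := Ideal.mul_mem_right (X (Sum.inl v)) _ h₁
      rw [sub_mul, X, monomial_mul, monomial_mul, one_mul] at h₂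
      simpa using Ideal.add_mem _ h₂ hmem
    by_cases hv' : m' (Sum.inl v) = 0
    · have hvr : m' (Sum.inr v) ≠ 0 := by
        have := congrFun (congrArg Prod.fst h) v
        rw [weight_segreWeight_fst, weight_segreWeight_fst] at this
        omega
      obtain ⟨u, hu⟩ : ∃ u, m' (Sum.inl u) ≠ 0 := by
        by_contra! h0
        have := congrArg Prod.snd h
        rw [weight_segreWeight_snd, weight_segreWeight_snd, hn] at this
        simp [h0] at this
      have huv : u ≠ v := by
        rintro rfl
        exact hu hv'
      have huU : u ∈ U := hm' (Finsupp.mem_support_iff.2 hu)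
      obtain ⟨m₂, rfl⟩ : ∃ m₂, m' = m₂ + Finsupp.single (Sum.inr v) 1 +
          Finsupp.single (Sum.inl u) 1 := by
        refine ⟨m' - (Finsupp.single (Sum.inr v) 1 + Finsupp.single (Sum.inl u) 1), ?_⟩
        rw [add_assoc, tsub_add_cancel_of_le]
        intro s
        rcases s with s | s
        · rcases eq_or_ne s u with rfl | hs
          · simpa using Nat.one_le_iff_ne_zero.2 hu
          · simp [hs.symm]
        · rcases eq_or_ne s v with rfl | hs
          · simpa using Nat.one_le_iff_ne_zero.2 hvr
          · simp [hs.symm]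
      refine ⟨m₂ + Finsupp.single (Sum.inr u) 1, fun s hs => ?_, ?_, ?_⟩
      · rcases Finset.mem_union.1 (Finsupp.support_add hs) with hs | hs
        · refine hm' ?_
          rw [Finset.mem_coe, Finsupp.mem_support_iff] at *
          simp [hs]
        · rw [Finset.mem_singleton.1 (Finsupp.support_single_subset hs)]
          exact huU
      · rw [weight_add_single, weight_add_single, weight_add_single, weight_add_single,
          add_assoc, add_assoc]
        congr 1
        simp [segreWeight, add_comm]
      · have e : monomial (m₂ + Finsupp.single (Sum.inr u) 1 + Finsupp.single (Sum.inl v) 1)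
              (1 : k) - monomial (m₂ + Finsupp.single (Sum.inr v) 1 +
                Finsupp.single (Sum.inl u) 1) 1 = monomial m₂ 1 * edgeBinomial k v u := by
          simp only [edgeBinomial, X, monomial_mul, mul_sub, mul_one, add_assoc]
          rw [add_comm (Finsupp.single (Sum.inr u) 1)]
        rw [e]
        exact Ideal.mul_mem_left _ _ (edgeBinomial_mem_inducedEdgeIdeal hvU huU huv.symm)
    · have e : m' - Finsupp.single (Sum.inl v) 1 + Finsupp.single (Sum.inl v) 1 = m' :=
        tsub_add_cancel_of_le (by simpa using Nat.one_le_iff_ne_zero.2 hv')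
      refine ⟨m' - Finsupp.single (Sum.inl v) 1, fun s hs => hm' ?_, by rw [e], ?_⟩
      · exact Finsupp.support_tsub hs
      · rw [e, sub_self]
        exact Ideal.zero_mem _

/-- The variables of a complete component are regular modulo the edge ideal. -/
theorem mem_of_X_inl_mul_mem {U : Set V} {L : Ideal (MvPolynomial (V ⊕ V) k)}
    (hL : IsFreeOf (vertexVars U) L) {v : V} (hv : v ∈ U) {p : MvPolynomial (V ⊕ V) k}
    (hp : X (Sum.inl v) * p ∈ inducedEdgeIdeal k ⊤ U ⊔ L) : p ∈ inducedEdgeIdeal k ⊤ U ⊔ L := by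
  classical
  let w : V ⊕ V → (V → ℕ) × ℕ := fun s => if s ∈ vertexVars U then segreWeight V s else 0
  have hw0 : ∀ s ∉ vertexVars U, w s = 0 := fun s hs => if_neg hs
  have hweq (m : V ⊕ V →₀ ℕ) (hm : ↑m.support ⊆ vertexVars U) :
      Finsupp.weight w m = Finsupp.weight (segreWeight V) m := by
    rw [Finsupp.weight_apply, Finsupp.weight_apply]
    exact Finset.sum_congr rfl fun s hs => by simp only [w, if_pos (hm hs)]
  refine mem_of_X_mul_mem hw0 (IsWeightedHomogeneousIdeal.sup ?_
    (hL.isWeightedHomogeneousIdeal hw0)) ?_ (fun m m' hm hm' h => ?_)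
    (s := Sum.inl v) hv hp
  · refine isWeightedHomogeneousIdeal_span _ ?_
    rintro _ ⟨a, ha, b, hb, -, rfl⟩
    refine ⟨w (Sum.inl a) + w (Sum.inr b), Submodule.sub_mem
      (weightedHomogeneousSubmodule k w (w (Sum.inl a) + w (Sum.inr b)))
      ((isWeightedHomogeneous_X k w _).mul (isWeightedHomogeneous_X k w _)) ?_⟩
    have e : w (Sum.inl a) + w (Sum.inr b) = w (Sum.inr a) + w (Sum.inl b) := by
      simp [w, ha, hb, segreWeight]
    rw [e]
    exact (isWeightedHomogeneous_X k w _).mul (isWeightedHomogeneous_X k w _)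
  · have : inducedEdgeIdeal k ⊤ U ⊔ L ≤
        (inducedEdgeIdeal k ⊤ U ⊔ L).comap (setOne k (vertexVars U)) := by
      refine sup_le (inducedEdgeIdeal_le.2 fun a ha b hb _ => ?_) fun f hf => ?_
      · rw [Ideal.mem_comap, edgeBinomial, map_sub, map_mul, map_mul,
          setOne_X_of_mem (inl_mem_vertexVars.2 ha), setOne_X_of_mem (inl_mem_vertexVars.2 hb),
          setOne_X_of_mem (inr_mem_vertexVars.2 ha), setOne_X_of_mem (inr_mem_vertexVars.2 hb),
          sub_self]
        exact Ideal.zero_mem _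
      · exact Submodule.mem_sup_right (hL.algHom_mem (fun s hs => setOne_X_of_notMem hs) hf)
    exact fun f hf => this hf
  · rw [hweq m hm, hweq m' hm'] at h
    exact Submodule.mem_sup_left (monomial_sub_monomial_mem U _ m m' rfl hm hm' h)

/-- A complete component raises the regularity by at most one. -/
theorem RegLE.complete_sup {r : ℤ} (U : Finset V) :
    ∀ {L : Ideal (MvPolynomial (V ⊕ V) k)}, IsFreeOf (vertexVars (U : Set V)) L →
      IsHomogeneousIdeal L → RegLE (varIdeal k (vertexVars (U : Set V)) ⊔ L) r →
      RegLE (inducedEdgeIdeal k ⊤ (U : Set V) ⊔ L) (r + 1) := by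
  induction U using Finset.induction_on with
  | empty =>
    intro L _ _ h
    have h1 : varIdeal k (vertexVars ((∅ : Finset V) : Set V)) ⊔ L = L :=
      sup_eq_right.2 (varIdeal_le.2 fun s hs => absurd hs (by simp [vertexVars]))
    have h2 : inducedEdgeIdeal k ⊤ ((∅ : Finset V) : Set V) ⊔ L = L :=
      sup_eq_right.2 (inducedEdgeIdeal_le.2 fun s hs => absurd hs (by simp))
    rw [h1] at h
    rw [h2]
    exact h.mono (by omega)
  | insert n U hn ih =>
    intro L hL hLh h
    have hcoe : ((insert n U : Finset V) : Set V) = insert n (U : Set V) := Finset.coe_insert n U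
    rw [hcoe] at hL h ⊢
    have hhom : IsHomogeneousIdeal (inducedEdgeIdeal k ⊤ (insert n (U : Set V)) ⊔ L) :=
      (isHomogeneousIdeal_inducedEdgeIdeal _ _).sup hLh
    refine RegLE.of_sup_span_X (s := Sum.inl n) hhom
      (fun p hp => mem_of_X_inl_mul_mem hL (Set.mem_insert n _) hp) ?_
    rw [completeEdgeIdeal_sup_X_eq_inf (by simpa using hn) hL]
    have hvars : vertexVars (insert n (U : Set V)) =
        vertexVars (U : Set V) ∪ vertexVars {n} := by
      rw [← vertexVars_union, Set.union_singleton]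
    have hsplit : vertexVars (insert n (U : Set V)) =
        (((insert n U).image Sum.inr : Finset (V ⊕ V)) : Set (V ⊕ V)) ∪
          Sum.inl '' insert n (U : Set V) := by
      ext s
      rcases s with s | s <;> simp
    have hsplit' : vertexVars (insert n (U : Set V)) = ((U.image Sum.inr : Finset (V ⊕ V)) :
        Set (V ⊕ V)) ∪ (Sum.inl '' insert n (U : Set V) ∪ vertexVars {n}) := by
      ext s
      rcases s with s | s <;> simp [or_comm]
    have hsub {Z : Set (V ⊕ V)} (hZ : Z ⊆ vertexVars (insert n (U : Set V))) :
        IsFreeOf Z L := hL.mono hZ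
    refine RegLE.inf (r' := r) ?_ ?_ ?_ ?_ ?_ le_rfl
    · exact (isHomogeneousIdeal_inducedEdgeIdeal _ _).sup
        ((isHomogeneousIdeal_varIdeal _).sup hLh)
    · exact (isHomogeneousIdeal_varIdeal _).sup hLh
    · refine ih ((isFreeOf_span_X (disjoint_vertexVars (by simpa using hn))).sup
        (hsub (vertexVars_mono (Set.subset_insert _ _))))
        ((isHomogeneousIdeal_varIdeal _).sup hLh) ?_
      rwa [← sup_assoc, ← varIdeal_union, ← hvars]
    · refine RegLE.mono (RegLE.of_varIdeal_sup ((insert n U).image Sum.inr)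
        ((isFreeOf_span_X ?_).sup (hsub ?_)) ((isHomogeneousIdeal_varIdeal _).sup hLh) ?_)
        (r := r) (by omega)
      · rw [Set.disjoint_left]
        rintro (s | s) <;> simp
      · rw [hsplit]
        exact Set.subset_union_left
      · rwa [hsplit, varIdeal_union, sup_assoc] at h
    · have e : inducedEdgeIdeal k ⊤ (U : Set V) ⊔ (varIdeal k (vertexVars {n}) ⊔ L) ⊔
          (varIdeal k (Sum.inl '' insert n (U : Set V)) ⊔ L) =
          varIdeal k (Sum.inl '' insert n (U : Set V) ∪ vertexVars {n}) ⊔ L := by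
        rw [varIdeal_union]
        apply le_antisymm
        · refine sup_le (sup_le (inducedEdgeIdeal_le.2 fun v hv w hw _ => ?_)
            (sup_le (le_sup_right.trans le_sup_left) le_sup_right))
            (sup_le (le_sup_left.trans le_sup_left) le_sup_right)
          refine Submodule.mem_sup_left (Submodule.mem_sup_left (Ideal.sub_mem _
            (Ideal.mul_mem_right _ _ (X_mem_varIdeal ⟨v, Set.mem_insert_of_mem _ hv, rfl⟩))
            (Ideal.mul_mem_left _ _ (X_mem_varIdeal ⟨w, Set.mem_insert_of_mem _ hw, rfl⟩))))
        · exact sup_le (sup_le (le_sup_left.trans le_sup_right)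
            (le_sup_left.trans (le_sup_right.trans le_sup_left))) (le_sup_right.trans le_sup_right)
      rw [e]
      refine RegLE.of_varIdeal_sup (U.image Sum.inr) ((isFreeOf_span_X ?_).sup (hsub ?_))
        ((isHomogeneousIdeal_varIdeal _).sup hLh) ?_
      · rw [Set.disjoint_left]
        rintro (s | s)
        · simp
        · simp only [Finset.coe_image, Set.mem_image, Finset.mem_coe, Sum.inr.injEq,
            exists_eq_right, Set.mem_union, reduceCtorEq, and_false, exists_false, false_or,
            inr_mem_vertexVars, Set.mem_singleton_iff]
          rintro hs rfl
          exact hn hs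
      · rw [hsplit']
        exact Set.subset_union_left
      · rwa [hsplit', varIdeal_union, sup_assoc] at h

end CompleteGraphs

/-! ### Joins and disjoint unions -/

section Joins

variable {k : Type*} [Field k] {V : Type*} {G : SimpleGraph V} {U U₁ U₂ : Set V}
  {L : Ideal (MvPolynomial (V ⊕ V) k)}

theorem setZero_mem_of_mem_edgeIdeal_sup (hL : IsFreeOf (vertexVars U) L)
    {f : MvPolynomial (V ⊕ V) k} (hf : f ∈ inducedEdgeIdeal k G U ⊔ L) :
    setZero k (vertexVars U) f ∈ L := by
  have h : inducedEdgeIdeal k G U ⊔ L ≤ L.comap (setZero k (vertexVars U)) := by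
    refine sup_le (inducedEdgeIdeal_le.2 fun v hv w _ _ => ?_) fun p hp => Ideal.mem_comap.2
      (hL.algHom_mem (fun s hs => setZero_X_of_notMem hs) hp)
    rw [Ideal.mem_comap, setZero_edgeBinomial_of_left_mem (inl_mem_vertexVars.2 hv)
      (inr_mem_vertexVars.2 hv)]
    exact L.zero_mem
  exact Ideal.mem_comap.1 (h hf)

theorem setZero_mem_of_mem_varIdeal_sup (hU : Disjoint U₁ U₂) (hL : IsFreeOf (vertexVars U₁) L)
    {f : MvPolynomial (V ⊕ V) k}
    (hf : f ∈ inducedEdgeIdeal k G U₂ ⊔ (varIdeal k (vertexVars U₁) ⊔ L)) :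
    setZero k (vertexVars U₁) f ∈ inducedEdgeIdeal k G U₂ ⊔ L := by
  have h : inducedEdgeIdeal k G U₂ ⊔ (varIdeal k (vertexVars U₁) ⊔ L) ≤
      (inducedEdgeIdeal k G U₂ ⊔ L).comap (setZero k (vertexVars U₁)) := by
    refine sup_le (inducedEdgeIdeal_le.2 fun v hv w hw hvw => ?_)
      (sup_le (varIdeal_le.2 fun s hs => ?_) fun p hp => Ideal.mem_comap.2 ?_)
    · have hv' : v ∉ U₁ := Set.disjoint_right.1 hU hv
      have hw' : w ∉ U₁ := Set.disjoint_right.1 hU hw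
      rw [Ideal.mem_comap, setZero_edgeBinomial_of_notMem hv' hv' hw' hw']
      exact Submodule.mem_sup_left (edgeBinomial_mem_inducedEdgeIdeal hv hw hvw)
    · rw [Ideal.mem_comap, setZero_X_of_mem hs]
      exact Ideal.zero_mem _
    · exact Submodule.mem_sup_right (hL.algHom_mem (fun s hs => setZero_X_of_notMem hs) hp)
  exact Ideal.mem_comap.1 (h hf)

/-- The projection to the polynomials all of whose terms involve variables of `U₁` and of `U₂`. It
is `(1 - π₂)(1 - π₁)`, where `πᵢ` sets the variables of `Uᵢ` to zero. -/
noncomputable def mixedPart (k : Type*) [Field k] {V : Type*} (U₁ U₂ : Set V)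
    (f : MvPolynomial (V ⊕ V) k) : MvPolynomial (V ⊕ V) k :=
  f - setZero k (vertexVars U₁) f -
    (setZero k (vertexVars U₂) f - setZero k (vertexVars U₂) (setZero k (vertexVars U₁) f))

theorem mixedPart_add (f g : MvPolynomial (V ⊕ V) k) :
    mixedPart k U₁ U₂ (f + g) = mixedPart k U₁ U₂ f + mixedPart k U₁ U₂ g := by
  simp only [mixedPart, map_add]
  ring

/-- By the Plücker relation, the product of a minor of `U₁` and a variable of a vertex adjacent
to all of `U₁` is a combination of minors of edges. -/
theorem mul_edgeBinomial_mem (hadj : ∀ v ∈ U₁, ∀ w ∈ U₂, G.Adj v w)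
    (hU : U₁ ∪ U₂ ⊆ U) {v w : V} (hv : v ∈ U₁) (hw : w ∈ U₁) {p : MvPolynomial (V ⊕ V) k}
    (hp : p ∈ varIdeal k (vertexVars U₂)) :
    p * edgeBinomial k v w ∈ inducedEdgeIdeal k G U := by
  have h (u : V) (hu : u ∈ U₁) (j : V) (hj : j ∈ U₂) :
      edgeBinomial k j u ∈ inducedEdgeIdeal k G U :=
    edgeBinomial_mem_inducedEdgeIdeal (hU (Or.inr hj)) (hU (Or.inl hu)) (hadj u hu j hj).symm
  induction hp using Submodule.span_induction with
  | mem x hx =>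
    obtain ⟨s | s, hs, rfl⟩ := hx
    · have e : X (Sum.inl s) * edgeBinomial k v w =
          X (Sum.inl v) * edgeBinomial k s w - X (Sum.inl w) * edgeBinomial k s v := by
        unfold edgeBinomial
        ring
      rw [e]
      exact Ideal.sub_mem _ (Ideal.mul_mem_left _ _ (h w hw s hs))
        (Ideal.mul_mem_left _ _ (h v hv s hs))
    · have e : X (Sum.inr s) * edgeBinomial k v w =
          X (Sum.inr v) * edgeBinomial k s w - X (Sum.inr w) * edgeBinomial k s v := by
        unfold edgeBinomial
        ring
      rw [e]
      exact Ideal.sub_mem _ (Ideal.mul_mem_left _ _ (h w hw s hs))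
        (Ideal.mul_mem_left _ _ (h v hv s hs))
  | zero => simp
  | add x y _ _ hx hy =>
    rw [add_mul]
    exact Ideal.add_mem _ hx hy
  | smul a x _ hx =>
    rw [smul_eq_mul, mul_assoc]
    exact Ideal.mul_mem_left _ _ hx

theorem mixedPart_mem_of_mem_complete (hU : Disjoint U₁ U₂)
    (hadj : ∀ v ∈ U₁, ∀ w ∈ U₂, G.Adj v w) (hL : IsFreeOf (vertexVars (U₁ ∪ U₂)) L)
    {f : MvPolynomial (V ⊕ V) k} (hf : f ∈ inducedEdgeIdeal k ⊤ (U₁ ∪ U₂) ⊔ L) :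
    mixedPart k U₁ U₂ f ∈ inducedEdgeIdeal k G (U₁ ∪ U₂) ⊔ L := by
  have hL₁ (p) (hp : p ∈ L) : setZero k (vertexVars U₁) p ∈ L :=
    (hL.mono (vertexVars_mono Set.subset_union_left)).algHom_mem
      (fun s hs => setZero_X_of_notMem hs) hp
  have hL₂ (p) (hp : p ∈ L) : setZero k (vertexVars U₂) p ∈ L :=
    (hL.mono (vertexVars_mono Set.subset_union_right)).algHom_mem
      (fun s hs => setZero_X_of_notMem hs) hp
  obtain ⟨q, hq, l, hl, rfl⟩ := Submodule.mem_sup.1 hf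
  rw [mixedPart_add]
  refine Ideal.add_mem _ (Submodule.mem_sup_left ?_) (Submodule.mem_sup_right
    (L.sub_mem (L.sub_mem hl (hL₁ l hl)) (L.sub_mem (hL₂ l hl) (hL₂ _ (hL₁ l hl)))))
  have key : ∀ a, mixedPart k U₁ U₂ (a * q) ∈ inducedEdgeIdeal k G (U₁ ∪ U₂) := by
    clear hf
    induction hq using Submodule.span_induction with
    | mem x hx =>
      obtain ⟨v, hv, w, hw, -, rfl⟩ := hx
      intro a
      rcases hv with hv | hv <;> rcases hw with hw | hw
      · have hv' : v ∉ U₂ := Set.disjoint_left.1 hU hv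
        have hw' : w ∉ U₂ := Set.disjoint_left.1 hU hw
        have e : mixedPart k U₁ U₂ (a * edgeBinomial k v w) =
            (a - setZero k (vertexVars U₂) a) * edgeBinomial k v w := by
          rw [mixedPart, map_mul, map_mul, setZero_edgeBinomial_of_left_mem hv hv,
            setZero_edgeBinomial_of_notMem hv' hv' hw' hw', mul_zero, map_zero]
          ring
        rw [e]
        exact mul_edgeBinomial_mem hadj le_rfl hv hw (sub_setZero_mem _ a)
      · have e : mixedPart k U₁ U₂ (a * edgeBinomial k v w) = a * edgeBinomial k v w := by
          rw [mixedPart, map_mul, map_mul, setZero_edgeBinomial_of_left_mem hv hv,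
            setZero_edgeBinomial_of_right_mem hw hw, mul_zero, mul_zero, map_zero]
          ring
        rw [e]
        exact Ideal.mul_mem_left _ _ (edgeBinomial_mem_inducedEdgeIdeal (Or.inl hv) (Or.inr hw)
          (hadj v hv w hw))
      · have e : mixedPart k U₁ U₂ (a * edgeBinomial k v w) = a * edgeBinomial k v w := by
          rw [mixedPart, map_mul, map_mul,
            setZero_edgeBinomial_of_right_mem (W := vertexVars U₁) hw hw,
            setZero_edgeBinomial_of_left_mem (W := vertexVars U₂) hv hv, mul_zero, mul_zero,
            map_zero]
          ring
        rw [e]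
        exact Ideal.mul_mem_left _ _ (edgeBinomial_mem_inducedEdgeIdeal (Or.inr hv) (Or.inl hw)
          (hadj w hw v hv).symm)
      · have hv' : v ∉ U₁ := Set.disjoint_right.1 hU hv
        have hw' : w ∉ U₁ := Set.disjoint_right.1 hU hw
        have e : mixedPart k U₁ U₂ (a * edgeBinomial k v w) =
            (a - setZero k (vertexVars U₁) a) * edgeBinomial k v w := by
          rw [mixedPart, map_mul, map_mul, map_mul,
            setZero_edgeBinomial_of_left_mem (W := vertexVars U₂) hv hv,
            setZero_edgeBinomial_of_notMem (W := vertexVars U₁) hv' hv' hw' hw',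
            setZero_edgeBinomial_of_left_mem (W := vertexVars U₂) hv hv]
          ring
        rw [e]
        exact mul_edgeBinomial_mem (fun x hx y hy => (hadj y hy x hx).symm)
          (Set.union_comm U₂ U₁).le hv hw (sub_setZero_mem _ a)
    | zero => simp [mixedPart]
    | add x y _ _ hx hy =>
      intro a
      rw [mul_add, mixedPart_add]
      exact Ideal.add_mem _ (hx a) (hy a)
    | smul b x _ hx =>
      intro a
      rw [smul_eq_mul, ← mul_assoc]
      exact hx _
  simpa using key 1

theorem mixedPart_mem_varIdeal_left (hU : Disjoint U₁ U₂) (f : MvPolynomial (V ⊕ V) k) :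
    mixedPart k U₁ U₂ f ∈ varIdeal k (vertexVars U₁) := by
  have h := sub_setZero_mem (k := k) (vertexVars U₁) f
  have h₁ : varIdeal k (vertexVars U₁) ≤
      (varIdeal k (vertexVars U₁)).comap (setZero k (vertexVars U₂)) := by
    refine varIdeal_le.2 fun s hs => ?_
    rw [Ideal.mem_comap, setZero_X_of_notMem (Set.disjoint_left.1 (disjoint_vertexVars hU) hs)]
    exact X_mem_varIdeal hs
  have h₂ := Ideal.mem_comap.1 (h₁ h)
  rw [map_sub] at h₂
  exact Ideal.sub_mem _ h h₂

theorem mixedPart_mem_varIdeal_right (f : MvPolynomial (V ⊕ V) k) :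
    mixedPart k U₁ U₂ f ∈ varIdeal k (vertexVars U₂) := by
  have h := sub_setZero_mem (k := k) (vertexVars U₂) (f - setZero k (vertexVars U₁) f)
  rwa [map_sub] at h

/-- A polynomial in both `(x_v, y_v : v ∈ U₁) + J_{U₂}` and `(x_v, y_v : v ∈ U₂) + J_{U₁}`
differs from its mixed part by an element of `J_{U₁} + J_{U₂}`. -/
theorem sub_mixedPart_mem (hU : Disjoint U₁ U₂) (hL : IsFreeOf (vertexVars (U₁ ∪ U₂)) L)
    {f : MvPolynomial (V ⊕ V) k}
    (hf₁ : f ∈ inducedEdgeIdeal k G U₂ ⊔ (varIdeal k (vertexVars U₁) ⊔ L))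
    (hf₂ : f ∈ inducedEdgeIdeal k G U₁ ⊔ (varIdeal k (vertexVars U₂) ⊔ L)) :
    f - mixedPart k U₁ U₂ f ∈ inducedEdgeIdeal k G (U₁ ∪ U₂) ⊔ L := by
  have hL₁ := hL.mono (vertexVars_mono Set.subset_union_left)
  have hL₂ := hL.mono (vertexVars_mono Set.subset_union_right)
  have hle₁ : inducedEdgeIdeal k G U₁ ⊔ L ≤ inducedEdgeIdeal k G (U₁ ∪ U₂) ⊔ L :=
    sup_le_sup_right (inducedEdgeIdeal_le.2 fun v hv w hw h =>
      edgeBinomial_mem_inducedEdgeIdeal (Or.inl hv) (Or.inl hw) h) _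
  have hle₂ : inducedEdgeIdeal k G U₂ ⊔ L ≤ inducedEdgeIdeal k G (U₁ ∪ U₂) ⊔ L :=
    sup_le_sup_right (inducedEdgeIdeal_le.2 fun v hv w hw h =>
      edgeBinomial_mem_inducedEdgeIdeal (Or.inr hv) (Or.inr hw) h) _
  have h₁ := setZero_mem_of_mem_varIdeal_sup hU hL₁ hf₁
  have h₂ := setZero_mem_of_mem_varIdeal_sup hU.symm hL₂ hf₂
  have h₃ := setZero_mem_of_mem_edgeIdeal_sup hL₂ h₁
  have e : f - mixedPart k U₁ U₂ f = setZero k (vertexVars U₁) f +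
      (setZero k (vertexVars U₂) f -
        setZero k (vertexVars U₂) (setZero k (vertexVars U₁) f)) := by
    rw [mixedPart]
    abel
  rw [e]
  exact Ideal.add_mem _ (hle₂ h₁) (Ideal.sub_mem _ (hle₁ h₂) (Submodule.mem_sup_right h₃))

theorem joinEdgeIdeal_le_left :
    inducedEdgeIdeal k G (U₁ ∪ U₂) ⊔ L ≤
      inducedEdgeIdeal k G U₂ ⊔ (varIdeal k (vertexVars U₁) ⊔ L) := by
  have h {v : V} (hv : v ∈ U₁) {s : V ⊕ V} (hs : Sum.elim id id s = v) :
      X s ∈ inducedEdgeIdeal k G U₂ ⊔ (varIdeal k (vertexVars U₁) ⊔ L) :=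
    Submodule.mem_sup_right (Submodule.mem_sup_left (X_mem_varIdeal (by
      subst hs
      exact hv)))
  refine sup_le (inducedEdgeIdeal_le.2 fun v hv w hw hvw => ?_) (le_sup_right.trans le_sup_right)
  rcases hv with hv | hv
  · exact edgeBinomial_mem_of_left (h hv rfl) (h hv rfl)
  rcases hw with hw | hw
  · exact edgeBinomial_mem_of_right (h hw rfl) (h hw rfl)
  exact Submodule.mem_sup_left (edgeBinomial_mem_inducedEdgeIdeal hv hw hvw)

theorem joinEdgeIdeal_le_right :
    inducedEdgeIdeal k G (U₁ ∪ U₂) ⊔ L ≤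
      inducedEdgeIdeal k G U₁ ⊔ (varIdeal k (vertexVars U₂) ⊔ L) := by
  rw [Set.union_comm]
  exact joinEdgeIdeal_le_left

/-- The edge ideal of a join is an intersection of three ideals: those of its two parts, with the
variables of the other part added, and that of the complete graph. -/
theorem joinEdgeIdeal_eq_inf (hU : Disjoint U₁ U₂) (hadj : ∀ v ∈ U₁, ∀ w ∈ U₂, G.Adj v w)
    (hL : IsFreeOf (vertexVars (U₁ ∪ U₂)) L) :
    inducedEdgeIdeal k G (U₁ ∪ U₂) ⊔ L =
      (inducedEdgeIdeal k G U₂ ⊔ (varIdeal k (vertexVars U₁) ⊔ L)) ⊓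
        (inducedEdgeIdeal k G U₁ ⊔ (varIdeal k (vertexVars U₂) ⊔ L)) ⊓
        (inducedEdgeIdeal k ⊤ (U₁ ∪ U₂) ⊔ L) := by
  apply le_antisymm
  · exact le_inf (le_inf joinEdgeIdeal_le_left joinEdgeIdeal_le_right)
      (sup_le_sup_right (inducedEdgeIdeal_le.2 fun v hv w hw h =>
        edgeBinomial_mem_inducedEdgeIdeal hv hw h.ne) _)
  · rintro f ⟨⟨hf₁, hf₂⟩, hf₃⟩
    have h := Ideal.add_mem _ (sub_mixedPart_mem hU hL hf₁ hf₂)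
      (mixedPart_mem_of_mem_complete hU hadj hL hf₃)
    rwa [sub_add_cancel] at h

/-- The sum of the intersection of the first two ideals in `joinEdgeIdeal_eq_inf` and the third one
is the intersection of the first two ideals for the complete graph. -/
theorem joinEdgeIdeal_inf_sup_complete (hU : Disjoint U₁ U₂)
    (hL : IsFreeOf (vertexVars (U₁ ∪ U₂)) L) :
    (inducedEdgeIdeal k G U₂ ⊔ (varIdeal k (vertexVars U₁) ⊔ L)) ⊓
        (inducedEdgeIdeal k G U₁ ⊔ (varIdeal k (vertexVars U₂) ⊔ L)) ⊔
        (inducedEdgeIdeal k ⊤ (U₁ ∪ U₂) ⊔ L) =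
      (inducedEdgeIdeal k ⊤ U₂ ⊔ (varIdeal k (vertexVars U₁) ⊔ L)) ⊓
        (inducedEdgeIdeal k ⊤ U₁ ⊔ (varIdeal k (vertexVars U₂) ⊔ L)) := by
  have htop (U : Set V) : inducedEdgeIdeal k G U ≤ inducedEdgeIdeal k ⊤ U :=
    inducedEdgeIdeal_le.2 fun v hv w hw h => edgeBinomial_mem_inducedEdgeIdeal hv hw h.ne
  apply le_antisymm
  · exact sup_le (inf_le_inf (sup_le_sup_right (htop _) _) (sup_le_sup_right (htop _) _))
      (le_inf joinEdgeIdeal_le_left joinEdgeIdeal_le_right)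
  · rintro f ⟨hf₁, hf₂⟩
    rw [← add_sub_cancel (mixedPart k U₁ U₂ f) f]
    exact Ideal.add_mem _ (Submodule.mem_sup_left
      ⟨Submodule.mem_sup_right (Submodule.mem_sup_left (mixedPart_mem_varIdeal_left hU f)),
        Submodule.mem_sup_right (Submodule.mem_sup_left (mixedPart_mem_varIdeal_right f))⟩)
      (Submodule.mem_sup_right (sub_mixedPart_mem hU hL hf₁ hf₂))

theorem joinEdgeIdeal_left_sup_right :
    inducedEdgeIdeal k G U₂ ⊔ (varIdeal k (vertexVars U₁) ⊔ L) ⊔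
        (inducedEdgeIdeal k G U₁ ⊔ (varIdeal k (vertexVars U₂) ⊔ L)) =
      varIdeal k (vertexVars (U₁ ∪ U₂)) ⊔ L := by
  have h {U : Set V} : inducedEdgeIdeal k G U ≤ varIdeal k (vertexVars U) :=
    inducedEdgeIdeal_le.2 fun v hv w _ _ =>
      edgeBinomial_mem_of_left (X_mem_varIdeal hv) (X_mem_varIdeal hv)
  rw [vertexVars_union, varIdeal_union]
  apply le_antisymm
  · exact sup_le (sup_le (h.trans (le_sup_right.trans le_sup_left))
      (sup_le (le_sup_left.trans le_sup_left) le_sup_right))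
      (sup_le (h.trans (le_sup_left.trans le_sup_left))
        (sup_le (le_sup_right.trans le_sup_left) le_sup_right))
  · exact sup_le (sup_le (le_sup_left.trans (le_sup_right.trans le_sup_left))
      (le_sup_left.trans (le_sup_right.trans le_sup_right)))
      (le_sup_right.trans (le_sup_right.trans le_sup_left))

theorem inducedEdgeIdeal_union (hadj : ∀ v ∈ U₁, ∀ w ∈ U₂, ¬ G.Adj v w) :
    inducedEdgeIdeal k G (U₁ ∪ U₂) =
      inducedEdgeIdeal k G U₁ ⊔ inducedEdgeIdeal k G U₂ := by
  apply le_antisymm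
  · refine inducedEdgeIdeal_le.2 fun v hv w hw hvw => ?_
    rcases hv with hv | hv <;> rcases hw with hw | hw
    · exact Submodule.mem_sup_left (edgeBinomial_mem_inducedEdgeIdeal hv hw hvw)
    · exact absurd hvw (hadj v hv w hw)
    · exact absurd hvw.symm (hadj w hw v hv)
    · exact Submodule.mem_sup_right (edgeBinomial_mem_inducedEdgeIdeal hv hw hvw)
  · exact sup_le (inducedEdgeIdeal_le.2 fun v hv w hw h =>
      edgeBinomial_mem_inducedEdgeIdeal (Or.inl hv) (Or.inl hw) h)
      (inducedEdgeIdeal_le.2 fun v hv w hw h =>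
        edgeBinomial_mem_inducedEdgeIdeal (Or.inr hv) (Or.inr hw) h)

variable [Fintype V] [DecidableEq V]

/-- The bound `reg(S/J_{G[U]}) ≤ ρ`, in the presence of further relations `L` that do not involve
the variables of `U`: they contribute the regularity of `L` with the variables of `U` killed. -/
def EdgeRegLE (k : Type*) [Field k] {V : Type*} [Fintype V] [DecidableEq V] (G : SimpleGraph V)
    (U : Set V) (ρ : ℤ) : Prop :=
  ∀ (L : Ideal (MvPolynomial (V ⊕ V) k)) (r : ℤ), IsFreeOf (vertexVars U) L →
    IsHomogeneousIdeal L → RegLE (varIdeal k (vertexVars U) ⊔ L) r →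
    RegLE (inducedEdgeIdeal k G U ⊔ L) (r + ρ)

theorem EdgeRegLE.mono {ρ ρ' : ℤ} (h : EdgeRegLE k G U ρ) (hρ : ρ ≤ ρ') : EdgeRegLE k G U ρ' :=
  fun L r hL hLh hr => (h L r hL hLh hr).mono (by omega)

theorem edgeRegLE_of_subsingleton (hU : U.Subsingleton) : EdgeRegLE k G U 0 := by
  classical
  intro L r hL hLh h
  have h0 : inducedEdgeIdeal k G U ⊔ L = L :=
    sup_eq_right.2 (inducedEdgeIdeal_le.2 fun v hv w hw hvw => absurd (hU hv hw) hvw.ne)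
  rw [h0, add_zero]
  have hf : ((Set.toFinite (vertexVars U)).toFinset : Set (V ⊕ V)) = vertexVars U :=
    Set.Finite.coe_toFinset _
  rw [← hf] at hL h
  exact RegLE.of_varIdeal_sup _ hL hLh h

theorem edgeRegLE_complete (hU : ∀ v ∈ U, ∀ w ∈ U, v ≠ w → G.Adj v w) : EdgeRegLE k G U 1 := by
  classical
  intro L r hL hLh h
  have h0 : inducedEdgeIdeal k G U = inducedEdgeIdeal k ⊤ U :=
    le_antisymm
      (inducedEdgeIdeal_le.2 fun v hv w hw h => edgeBinomial_mem_inducedEdgeIdeal hv hw h.ne)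
      (inducedEdgeIdeal_le.2 fun v hv w hw h =>
        edgeBinomial_mem_inducedEdgeIdeal hv hw (hU v hv w hw h))
  have hf : ((Set.toFinite U).toFinset : Set V) = U := Set.Finite.coe_toFinset _
  rw [h0, ← hf]
  rw [← hf] at hL h
  exact RegLE.complete_sup _ hL hLh h

/-- The regularity of a disjoint union is at most the sum of the regularities. -/
theorem EdgeRegLE.disjoint_union (hU : Disjoint U₁ U₂) (hadj : ∀ v ∈ U₁, ∀ w ∈ U₂, ¬ G.Adj v w)
    {ρ₁ ρ₂ : ℤ} (h₁ : EdgeRegLE k G U₁ ρ₁) (h₂ : EdgeRegLE k G U₂ ρ₂) :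
    EdgeRegLE k G (U₁ ∪ U₂) (ρ₁ + ρ₂) := by
  intro L r hL hLh h
  have hL₁ := hL.mono (vertexVars_mono Set.subset_union_left)
  have hL₂ := hL.mono (vertexVars_mono Set.subset_union_right)
  have h' : RegLE (inducedEdgeIdeal k G U₂ ⊔ (varIdeal k (vertexVars U₁) ⊔ L)) (r + ρ₂) := by
    refine h₂ _ r ((isFreeOf_span_X (disjoint_vertexVars hU).symm).sup hL₂)
      ((isHomogeneousIdeal_varIdeal _).sup hLh) ?_
    rwa [← sup_assoc, sup_comm (varIdeal k (vertexVars U₂)), ← varIdeal_union,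
      ← vertexVars_union]
  rw [sup_left_comm] at h'
  have := h₁ _ _ ((isFreeOf_inducedEdgeIdeal hU).sup hL₁)
    ((isHomogeneousIdeal_inducedEdgeIdeal _ _).sup hLh) h'
  rw [inducedEdgeIdeal_union hadj, sup_assoc]
  exact this.mono (by omega)

/-- The regularity of a join is at most the maximum of `2` and the regularities of the parts. -/
theorem EdgeRegLE.join (hU : Disjoint U₁ U₂) (hadj : ∀ v ∈ U₁, ∀ w ∈ U₂, G.Adj v w)
    {ρ : ℤ} (hρ : 2 ≤ ρ) (h₁ : EdgeRegLE k G U₁ ρ) (h₂ : EdgeRegLE k G U₂ ρ) :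
    EdgeRegLE k G (U₁ ∪ U₂) ρ := by
  intro L r hL hLh h
  have hL₁ := hL.mono (vertexVars_mono Set.subset_union_left)
  have hL₂ := hL.mono (vertexVars_mono Set.subset_union_right)
  have hh₁ {H : SimpleGraph V} : IsHomogeneousIdeal
      (inducedEdgeIdeal k H U₂ ⊔ (varIdeal k (vertexVars U₁) ⊔ L)) :=
    (isHomogeneousIdeal_inducedEdgeIdeal _ _).sup ((isHomogeneousIdeal_varIdeal _).sup hLh)
  have hh₂ {H : SimpleGraph V} : IsHomogeneousIdeal
      (inducedEdgeIdeal k H U₁ ⊔ (varIdeal k (vertexVars U₂) ⊔ L)) :=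
    (isHomogeneousIdeal_inducedEdgeIdeal _ _).sup ((isHomogeneousIdeal_varIdeal _).sup hLh)
  have hr₂ {H : SimpleGraph V} {ρ' : ℤ} (h' : EdgeRegLE k H U₂ ρ') :
      RegLE (inducedEdgeIdeal k H U₂ ⊔ (varIdeal k (vertexVars U₁) ⊔ L)) (r + ρ') := by
    refine h' _ r ((isFreeOf_span_X (disjoint_vertexVars hU).symm).sup hL₂)
      ((isHomogeneousIdeal_varIdeal _).sup hLh) ?_
    rwa [← sup_assoc, sup_comm (varIdeal k (vertexVars U₂)), ← varIdeal_union,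
      ← vertexVars_union]
  have hr₁ {H : SimpleGraph V} {ρ' : ℤ} (h' : EdgeRegLE k H U₁ ρ') :
      RegLE (inducedEdgeIdeal k H U₁ ⊔ (varIdeal k (vertexVars U₂) ⊔ L)) (r + ρ') := by
    refine h' _ r ((isFreeOf_span_X (disjoint_vertexVars hU)).sup hL₁)
      ((isHomogeneousIdeal_varIdeal _).sup hLh) ?_
    rwa [← sup_assoc, ← varIdeal_union, ← vertexVars_union]
  have hc (U : Set V) : EdgeRegLE k ⊤ U 1 := edgeRegLE_complete fun v _ w _ hvw => hvw
  rw [joinEdgeIdeal_eq_inf hU hadj hL]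
  refine RegLE.inf (r' := r + 1) (hh₁.inf hh₂)
    ((isHomogeneousIdeal_inducedEdgeIdeal _ _).sup hLh) ?_ ?_ ?_ (by omega)
  · refine RegLE.inf (r' := r) hh₁ hh₂ (hr₂ h₂) (hr₁ h₁) ?_ (by omega)
    rwa [joinEdgeIdeal_left_sup_right]
  · exact (hc _ L r hL hLh h).mono (by omega)
  · rw [joinEdgeIdeal_inf_sup_complete hU hL]
    refine RegLE.inf (r' := r) hh₁ hh₂ (hr₂ (hc _)) (hr₁ (hc _)) ?_ (by omega)
    rwa [joinEdgeIdeal_left_sup_right]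

end Joins

/-! ### The structure of cographs -/

section Cographs

variable {V : Type*}

/-- `G` has no induced path `a - b - c - d`. -/
def HasNoInducedP4 (G : SimpleGraph V) : Prop :=
  ∀ a b c d, G.Adj a b → G.Adj b c → G.Adj c d → ¬ G.Adj a c → ¬ G.Adj b d → G.Adj a d

theorem IsCograph.hasNoInducedP4 {G : SimpleGraph V} (hG : IsCograph G) : HasNoInducedP4 G := by
  intro a b c d hab hbc hcd hac hbd
  by_contra had
  have hac' : a ≠ c := by
    rintro rfl
    exact had hcd
  have hbd' : b ≠ d := by
    rintro rfl
    exact had hab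
  have had' : a ≠ d := by
    rintro rfl
    exact hac hcd.symm
  refine hG ⟨⟨⟨![a, b, c, d], ?_⟩, ?_⟩⟩
  · intro i j h
    fin_cases i <;> fin_cases j <;>
      simp_all [hab.ne, hbc.ne, hcd.ne, hab.ne', hbc.ne', hcd.ne']
  · intro i j
    change G.Adj (![a, b, c, d] i) (![a, b, c, d] j) ↔ _
    fin_cases i <;> fin_cases j <;>
      simp [SimpleGraph.pathGraph_adj, hab, hbc, hcd, hac, hbd, had, G.adj_comm b a,
        G.adj_comm c a, G.adj_comm d a, G.adj_comm c b, G.adj_comm d b, G.adj_comm d c]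

/-- The path on four vertices is self-complementary. -/
theorem HasNoInducedP4.compl {G : SimpleGraph V} (hG : HasNoInducedP4 G) :
    HasNoInducedP4 Gᶜ := by
  intro a b c d hab hbc hcd hac hbd
  by_contra had
  simp only [SimpleGraph.compl_adj, not_and, not_not] at *
  have hac' : a ≠ c := by
    rintro rfl
    exact hcd.2 (had hcd.1)
  have hbd' : b ≠ d := by
    rintro rfl
    exact hab.2 (had hab.1)
  have had' : a ≠ d := by
    rintro rfl
    exact hcd.2 (hac hac').symm
  exact hbc.2 (hG b d a c (hbd hbd') (had had').symm (hac hac') (fun h => hab.2 h.symm)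
    (fun h => hcd.2 h.symm))

variable [DecidableEq V]

/-- The vertex set `U` splits into two nonempty parts with no edges of `G` between them. -/
def IsSplitBy (G : SimpleGraph V) (U : Finset V) : Prop :=
  ∃ A B : Finset V, A.Nonempty ∧ B.Nonempty ∧ Disjoint A B ∧ A ∪ B = U ∧
    ∀ a ∈ A, ∀ b ∈ B, ¬ G.Adj a b

theorem IsSplitBy.insert {G : SimpleGraph V} (hG : HasNoInducedP4 G) {U : Finset V}
    (hU : IsSplitBy G U) {v : V} (hv : v ∉ U) :
    IsSplitBy G (insert v U) ∨ IsSplitBy Gᶜ (insert v U) := by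
  classical
  obtain ⟨A, B, hA, hB, hAB, rfl, hadj⟩ := hU
  by_cases hall : ∀ u ∈ A ∪ B, G.Adj v u
  · refine Or.inr ⟨{v}, A ∪ B, Finset.singleton_nonempty v, hA.mono Finset.subset_union_left,
      Finset.disjoint_singleton_left.2 hv, rfl, ?_⟩
    intro a ha b hb h
    rw [Finset.mem_singleton.1 ha] at h
    exact h.2 (hall b hb)
  push Not at hall
  obtain ⟨w, hw, hvw⟩ := hall
  -- `R` is the connected component of the non-neighbour `w` of `v`.
  let step : V → V → Prop := fun x y => x ∈ A ∪ B ∧ y ∈ A ∪ B ∧ G.Adj x y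
  let R := (A ∪ B).filter (Relation.ReflTransGen step w)
  have hwR : w ∈ R := Finset.mem_filter.2 ⟨hw, .refl⟩
  have hrest : ((A ∪ B) \ R).Nonempty := by
    have hside (C D : Finset V) (hCD : C ∪ D = A ∪ B) (hD : D.Nonempty) (hdis : Disjoint C D)
        (hadj' : ∀ a ∈ C, ∀ b ∈ D, ¬ G.Adj a b) (hwC : w ∈ C) : ((A ∪ B) \ R).Nonempty := by
      obtain ⟨d, hd⟩ := hD
      refine ⟨d, Finset.mem_sdiff.2 ⟨hCD ▸ Finset.mem_union_right C hd, fun hdR => ?_⟩⟩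
      have hC : ∀ x, Relation.ReflTransGen step w x → x ∈ C := by
        intro x hx
        induction hx with
        | refl => exact hwC
        | tail _ hxy ih =>
          have := hCD ▸ hxy.2.1
          exact (Finset.mem_union.1 this).resolve_right fun h => hadj' _ ih _ h hxy.2.2
      exact Finset.disjoint_left.1 hdis (hC d (Finset.mem_filter.1 hdR).2) hd
    rcases Finset.mem_union.1 hw with h | h
    · exact hside A B rfl hB hAB hadj h
    · exact hside B A (Finset.union_comm B A) hA hAB.symm (fun a ha b hb h => hadj b hb a ha h.symm)
        h
  have hRrest : ∀ a ∈ R, ∀ b ∈ (A ∪ B) \ R, ¬ G.Adj a b := by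
    intro a ha b hb h
    have ha' := Finset.mem_filter.1 ha
    have hb' := Finset.mem_sdiff.1 hb
    exact hb'.2 (Finset.mem_filter.2 ⟨hb'.1, ha'.2.tail ⟨ha'.1, hb'.1, h⟩⟩)
  have hRsub : R ⊆ A ∪ B := Finset.filter_subset _ _
  have hvR : v ∉ R := fun h => hv (hRsub h)
  have hvrest : v ∉ (A ∪ B) \ R := fun h => hv (Finset.mem_sdiff.1 h).1
  left
  by_cases h₁ : ∀ u ∈ R, ¬ G.Adj v u
  · refine ⟨R, Insert.insert v ((A ∪ B) \ R), ⟨w, hwR⟩, Finset.insert_nonempty _ _, ?_, ?_, ?_⟩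
    · exact Finset.disjoint_insert_right.2 ⟨hvR, Finset.disjoint_sdiff⟩
    · rw [Finset.union_insert, Finset.union_sdiff_of_subset hRsub]
    · intro a ha b hb
      rcases Finset.mem_insert.1 hb with rfl | hb
      · exact fun h => h₁ a ha h.symm
      · exact hRrest a ha b hb
  by_cases h₂ : ∀ u ∈ (A ∪ B) \ R, ¬ G.Adj v u
  · refine ⟨(A ∪ B) \ R, Insert.insert v R, hrest, Finset.insert_nonempty _ _, ?_, ?_, ?_⟩
    · exact Finset.disjoint_insert_right.2 ⟨hvrest, Finset.sdiff_disjoint⟩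
    · rw [Finset.union_insert, Finset.sdiff_union_of_subset hRsub]
    · intro a ha b hb
      rcases Finset.mem_insert.1 hb with rfl | hb
      · exact fun h => h₂ a ha h.symm
      · exact fun h => hRrest b hb a ha h.symm
  push Not at h₁ h₂
  obtain ⟨u, huR, hvu⟩ := h₁
  obtain ⟨c, hc, hvc⟩ := h₂
  -- Along a path from `w` to a neighbour of `v` there is an edge `b - a` with `v` adjacent to `a`
  -- but not to `b`; then `b - a - v - c` is an induced path.
  obtain ⟨b, a, hb, hba, hvb, hva⟩ : ∃ b a, Relation.ReflTransGen step w b ∧ step b a ∧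
      ¬ G.Adj v b ∧ G.Adj v a := by
    by_contra! hcon
    have : ∀ x, Relation.ReflTransGen step w x → ¬ G.Adj v x := by
      intro x hx
      induction hx with
      | refl => exact hvw
      | tail hx hxy ih => exact hcon _ _ hx hxy ih
    exact this u (Finset.mem_filter.1 huR).2 hvu
  have hbR : b ∈ R := Finset.mem_filter.2 ⟨hba.1, hb⟩
  have haR : a ∈ R := Finset.mem_filter.2 ⟨hba.2.1, hb.tail hba⟩
  exact absurd (hG b a v c hba.2.2 hva.symm hvc (fun h => hvb h.symm) (hRrest a haR c hc))
    (hRrest b hbR c hc)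

/-- A cograph with at least two vertices is a disjoint union or a join of smaller graphs. -/
theorem HasNoInducedP4.isSplitBy {G : SimpleGraph V} (hG : HasNoInducedP4 G) (U : Finset V) :
    2 ≤ U.card → IsSplitBy G U ∨ IsSplitBy Gᶜ U := by
  induction U using Finset.induction_on with
  | empty => simp
  | insert v U hv ih =>
    intro hcard
    rw [Finset.card_insert_of_notMem hv] at hcard
    rcases lt_or_ge U.card 2 with hlt | hge
    · obtain ⟨u, rfl⟩ := Finset.card_eq_one.1 (by omega : U.card = 1)
      have hvu : v ≠ u := by simpa using hv
      by_cases h : G.Adj v u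
      · refine Or.inr ⟨{v}, {u}, by simp, by simp, by simpa using hvu, rfl, ?_⟩
        simp [h]
      · refine Or.inl ⟨{v}, {u}, by simp, by simp, by simpa using hvu, rfl, ?_⟩
        simp [h]
    · rcases ih hge with h | h
      · exact h.insert hG hv
      · have := h.insert hG.compl hv
        rw [compl_compl] at this
        exact this.symm

end Cographs

/-! ### Disjoint unions of paths -/

section Copies

variable {V W W' : Type*} {G : SimpleGraph V} {U U' : Set V} {H : SimpleGraph W}
  {H' : SimpleGraph W'}

/-- The subgraph of `G` induced on `U` is a copy of `H`. -/
def IsInducedCopy (G : SimpleGraph V) (U : Set V) (H : SimpleGraph W) : Prop :=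
  ∃ g : W → V, Function.Injective g ∧ Set.range g = U ∧ ∀ x y, G.Adj (g x) (g y) ↔ H.Adj x y

theorem IsInducedCopy.sum (h : IsInducedCopy G U H) (h' : IsInducedCopy G U' H')
    (hU : Disjoint U U') (hadj : ∀ v ∈ U, ∀ w ∈ U', ¬ G.Adj v w) :
    IsInducedCopy G (U ∪ U') (H ⊕g H') := by
  obtain ⟨g, hg, rfl, hgH⟩ := h
  obtain ⟨g', hg', rfl, hgH'⟩ := h'
  refine ⟨Sum.elim g g', hg.sumElim hg' fun a b hab => ?_, Set.Sum.elim_range g g', ?_⟩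
  · exact Set.disjoint_left.1 hU ⟨a, rfl⟩ ⟨b, hab.symm⟩
  · rintro (x | x) (y | y)
    · simpa using hgH x y
    · simpa using hadj _ ⟨x, rfl⟩ _ ⟨y, rfl⟩
    · simpa using fun h => hadj _ ⟨y, rfl⟩ _ ⟨x, rfl⟩ (h.symm)
    · simpa using hgH' x y

theorem IsInducedCopy.of_iso (h : IsInducedCopy G U H) (e : H' ≃g H) : IsInducedCopy G U H' := by
  obtain ⟨g, hg, hgU, hgH⟩ := h
  refine ⟨g ∘ e, hg.comp e.injective, ?_, fun x y => ?_⟩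
  · rw [EquivLike.range_comp, hgU]
  · rw [Function.comp_apply, Function.comp_apply, hgH, e.map_adj_iff]

theorem isInducedCopy_univ_iff : IsInducedCopy G Set.univ H ↔ Nonempty (G ≃g H) := by
  constructor
  · rintro ⟨g, hg, hgU, hgH⟩
    exact ⟨SimpleGraph.Iso.symm
      ⟨Equiv.ofBijective g ⟨hg, Set.range_eq_univ.1 hgU⟩, fun {x y} => hgH x y⟩⟩
  · rintro ⟨e⟩
    exact ⟨e.symm, e.symm.injective, e.symm.surjective.range_eq, fun x y => e.symm.map_adj_iff⟩

/-- The disjoint union of `p` paths on three and `q` paths on two vertices. -/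
abbrev pathUnion (p q : ℕ) : SimpleGraph (Fin p × Fin 3 ⊕ Fin q × Fin 2) :=
  graphCopies p (SimpleGraph.pathGraph 3) ⊕g graphCopies q (SimpleGraph.pathGraph 2)

/-- Merging two disjoint unions of paths. -/
def pathUnionIso (p q p' q' : ℕ) :
    (pathUnion p q ⊕g pathUnion p' q') ≃g pathUnion (p + p') (q + q') where
  toEquiv := (Equiv.sumSumSumComm _ _ _ _).trans (Equiv.sumCongr
    ((Equiv.sumProdDistrib _ _ _).symm.trans (finSumFinEquiv.prodCongr (Equiv.refl _)))
    ((Equiv.sumProdDistrib _ _ _).symm.trans (finSumFinEquiv.prodCongr (Equiv.refl _))))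
  map_rel_iff' := by
    rintro ((⟨i, x⟩ | ⟨i, x⟩) | (⟨i, x⟩ | ⟨i, x⟩)) ((⟨j, y⟩ | ⟨j, y⟩) | (⟨j, y⟩ | ⟨j, y⟩)) <;>
      simp [graphCopies]
    all_goals
      intro h
      have := congrArg Fin.val h
      simp only [Fin.val_castAdd, Fin.val_natAdd] at this
      omega

end Copies

/-! ### The regularity of cographs -/

section CographRegularity

variable {V : Type*} {G : SimpleGraph V}

theorem isInducedCopy_pathUnion_zero_zero : IsInducedCopy G ∅ (pathUnion 0 0) :=
  ⟨fun x => isEmptyElim x, fun x => isEmptyElim x, Set.range_eq_empty _, fun x => isEmptyElim x⟩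

theorem isInducedCopy_pathUnion_zero_one {a b : V} (hab : G.Adj a b) :
    IsInducedCopy G {a, b} (pathUnion 0 1) := by
  refine ⟨Sum.elim (fun x => isEmptyElim x) (fun x => ![a, b] x.2), ?_, ?_, ?_⟩
  · rintro (⟨x, -⟩ | ⟨i, x⟩) (⟨y, -⟩ | ⟨j, y⟩) h
    · exact x.elim0
    · exact x.elim0
    · exact y.elim0
    · obtain rfl := Subsingleton.elim i j
      have := hab.ne
      have := hab.ne'
      fin_cases x <;> fin_cases y <;> simp_all
  · ext v
    constructor
    · rintro ⟨⟨x, -⟩ | ⟨i, x⟩, rfl⟩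
      · exact x.elim0
      · fin_cases x <;> simp
    · rintro (rfl | rfl)
      · exact ⟨Sum.inr (0, 0), rfl⟩
      · exact ⟨Sum.inr (0, 1), rfl⟩
  · rintro (⟨x, -⟩ | ⟨i, x⟩) (⟨y, -⟩ | ⟨j, y⟩)
    · exact x.elim0
    · exact x.elim0
    · exact y.elim0
    · obtain rfl := Subsingleton.elim i j
      fin_cases x <;> fin_cases y <;>
        simp [graphCopies, SimpleGraph.pathGraph_adj, hab, hab.symm]

theorem isInducedCopy_pathUnion_one_zero {a b c : V} (hab : G.Adj a b) (hbc : G.Adj b c)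
    (hac : ¬ G.Adj a c) (hne : a ≠ c) : IsInducedCopy G {a, b, c} (pathUnion 1 0) := by
  refine ⟨Sum.elim (fun x => ![a, b, c] x.2) (fun x => isEmptyElim x), ?_, ?_, ?_⟩
  · rintro (⟨i, x⟩ | ⟨x, -⟩) (⟨j, y⟩ | ⟨y, -⟩) h
    · obtain rfl := Subsingleton.elim i j
      have := hab.ne
      have := hab.ne'
      have := hbc.ne
      have := hbc.ne'
      fin_cases x <;> fin_cases y <;> simp_all
    · exact y.elim0
    · exact x.elim0
    · exact x.elim0
  · ext v
    constructor
    · rintro ⟨⟨i, x⟩ | ⟨x, -⟩, rfl⟩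
      · fin_cases x <;> simp
      · exact x.elim0
    · rintro (rfl | rfl | rfl)
      · exact ⟨Sum.inl (0, 0), rfl⟩
      · exact ⟨Sum.inl (0, 1), rfl⟩
      · exact ⟨Sum.inl (0, 2), rfl⟩
  · rintro (⟨i, x⟩ | ⟨x, -⟩) (⟨j, y⟩ | ⟨y, -⟩)
    · obtain rfl := Subsingleton.elim i j
      have hca : ¬ G.Adj c a := fun h => hac h.symm
      fin_cases x <;> fin_cases y <;>
        simp [graphCopies, SimpleGraph.pathGraph_adj, hab, hab.symm, hbc, hbc.symm, hac, hca]
    · exact y.elim0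
    · exact x.elim0
    · exact x.elim0

variable [Fintype V] [DecidableEq V]

/-- The regularity of a cograph on `n` vertices is at most `2n/3`. The defect `2n - 3ρ` of the bound
`ρ` is additive on disjoint unions, vanishes for the path on three vertices, is one for the path on
two vertices, and is at least two for every other connected cograph. -/
theorem HasNoInducedP4.exists_edgeRegLE (k : Type*) [Field k] (hG : HasNoInducedP4 G) (n : ℕ) :
    ∀ U : Finset V, U.card = n → ∃ ρ : ℕ, EdgeRegLE k G U ρ ∧ 3 * ρ ≤ 2 * n ∧
      ∀ d ≤ 1, 2 * n = 3 * ρ + d → ∃ p, IsInducedCopy G U (pathUnion p d) := by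
  induction n using Nat.strong_induction_on with
  | _ n ih =>
    intro U hUn
    rcases lt_or_ge n 2 with hn | hn
    · refine ⟨0, ?_, by omega, fun d hd hd' => ?_⟩
      · refine edgeRegLE_of_subsingleton fun v hv w hw => ?_
        exact Finset.card_le_one.1 (by omega) v hv w hw
      · obtain rfl : d = 0 := by omega
        obtain rfl : n = 0 := by omega
        rw [Finset.card_eq_zero.1 hUn, Finset.coe_empty]
        exact ⟨0, isInducedCopy_pathUnion_zero_zero⟩
    obtain ⟨A, B, hA, hB, hAB, rfl, hadj⟩ | ⟨A, B, hA, hB, hAB, rfl, hadj⟩ :=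
      hG.isSplitBy U (by omega)
    all_goals
      have hcard := Finset.card_union_of_disjoint hAB
      have hA0 := hA.card_pos
      have hB0 := hB.card_pos
      have hdis : Disjoint (A : Set V) (B : Set V) := Finset.disjoint_coe.2 hAB
      obtain ⟨ρA, hρA, hleA, hstA⟩ := ih A.card (by omega) A rfl
      obtain ⟨ρB, hρB, hleB, hstB⟩ := ih B.card (by omega) B rfl
      rw [Finset.coe_union]
    · refine ⟨ρA + ρB, ?_, by omega, fun d hd hd' => ?_⟩
      · rw [Nat.cast_add]
        exact hρA.disjoint_union hdis hadj hρB
      · obtain ⟨p, hp⟩ := hstA (2 * A.card - 3 * ρA) (by omega) (by omega)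
        obtain ⟨p', hp'⟩ := hstB (2 * B.card - 3 * ρB) (by omega) (by omega)
        obtain rfl : 2 * A.card - 3 * ρA + (2 * B.card - 3 * ρB) = d := by omega
        exact ⟨p + p', (hp.sum hp' hdis hadj).of_iso (pathUnionIso _ _ _ _).symm⟩
    · have hadj' : ∀ a ∈ (A : Set V), ∀ b ∈ (B : Set V), G.Adj a b := by
        intro a ha b hb
        by_contra h
        exact hadj a ha b hb ⟨fun hab => Set.disjoint_left.1 hdis ha (hab ▸ hb), h⟩
      by_cases hcomp : ∀ v ∈ (A ∪ B : Set V), ∀ w ∈ (A ∪ B : Set V), v ≠ w → G.Adj v w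
      · refine ⟨1, by exact_mod_cast edgeRegLE_complete hcomp, by omega, fun d hd hd' => ?_⟩
        obtain rfl : d = 1 := by omega
        obtain ⟨a, rfl⟩ := Finset.card_eq_one.1 (by omega : A.card = 1)
        obtain ⟨b, rfl⟩ := Finset.card_eq_one.1 (by omega : B.card = 1)
        refine ⟨0, ?_⟩
        rw [Finset.coe_singleton, Finset.coe_singleton, Set.singleton_union]
        exact isInducedCopy_pathUnion_zero_one (hadj' a (by simp) b (by simp))
      -- Two joined vertices form a complete graph, and `3 ρ ≤ 2 n` for `ρ = 2` needs `n ≥ 3`.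
      · have h3 : 3 ≤ n := by
          by_contra hlt
          obtain ⟨a, rfl⟩ := Finset.card_eq_one.1 (by omega : A.card = 1)
          obtain ⟨b, rfl⟩ := Finset.card_eq_one.1 (by omega : B.card = 1)
          have hab := hadj' a (by simp) b (by simp)
          refine hcomp ?_
          simp [hab, hab.symm]
        refine ⟨max (max ρA ρB) 2, ?_, by omega, fun d hd hd' => ?_⟩
        · refine EdgeRegLE.join hdis hadj' (by simp) (hρA.mono ?_) (hρB.mono ?_) <;> simp
        -- If `ρ` came from one side, the vertices of the other would make the defect at least `2`.
        -- So `ρ = 2`, and there are three vertices.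
        · obtain rfl : d = 0 := by omega
          refine ⟨1, ?_⟩
          have hthree {C D : Finset V} (hC : C.card = 1) (hD : D.card = 2)
              (hCD : ∀ c ∈ C, ∀ d ∈ D, G.Adj c d)
              (hnc : ¬ ∀ v ∈ (C ∪ D : Set V), ∀ w ∈ (C ∪ D : Set V), v ≠ w → G.Adj v w) :
              IsInducedCopy G (C ∪ D : Set V) (pathUnion 1 0) := by
            obtain ⟨b, rfl⟩ := Finset.card_eq_one.1 hC
            obtain ⟨a, c, hac, rfl⟩ := Finset.card_eq_two.1 hD
            have hba := hCD b (by simp) a (by simp)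
            have hbc := hCD b (by simp) c (by simp)
            have hna : ¬ G.Adj a c := by
              intro h
              refine hnc ?_
              simp [hba, hbc, hba.symm, hbc.symm, h, h.symm]
            have e : ((({b} : Finset V) : Set V) ∪ (({a, c} : Finset V) : Set V)) = {a, b, c} := by
              ext v
              simp only [Finset.coe_singleton, Finset.coe_pair, Set.mem_union,
                Set.mem_singleton_iff, Set.mem_insert_iff]
              tauto
            rw [e]
            exact isInducedCopy_pathUnion_one_zero hba.symm hbc hna hac
          rcases (by omega : A.card = 1 ∧ B.card = 2 ∨ B.card = 1 ∧ A.card = 2) with h | h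
          · exact hthree h.1 h.2 hadj' hcomp
          · rw [Set.union_comm] at hcomp ⊢
            exact hthree h.1 h.2 (fun b hb a ha => (hadj' a ha b hb).symm) hcomp

end CographRegularity

/-! ### The lower bound for disjoint unions of paths -/

section CompleteIntersections

variable {k : Type*} [Field k] {V : Type*}

theorem exists_weightedHomogeneousComponent_eq_zero {σ : Type*} (w : σ → ℕ)
    (p : MvPolynomial σ k) : ∃ N, ∀ e, N ≤ e → weightedHomogeneousComponent w e p = 0 :=
  ⟨weightedTotalDegree w p + 1, fun _ he =>
    weightedHomogeneousComponent_eq_zero _ _ (Nat.lt_of_succ_le he)⟩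

/-- If `x_v` is regular modulo `I` and `I` does not involve `y_w`, then
`x_v y_w - y_v x_w` is regular modulo `I`: as a polynomial in `y_w` it has the regular leading
coefficient `x_v`. -/
theorem mem_of_edgeBinomial_mul_mem {I : Ideal (MvPolynomial (V ⊕ V) k)} {v w : V} (hvw : v ≠ w)
    (hI : IsFreeOf {Sum.inr w} I) (hreg : ∀ p, X (Sum.inl v) * p ∈ I → p ∈ I)
    {p : MvPolynomial (V ⊕ V) k} (hp : edgeBinomial k v w * p ∈ I) : p ∈ I := by
  classical
  let u : V ⊕ V → ℕ := Pi.single (Sum.inr w) 1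
  have hu : ∀ s ∉ ({Sum.inr w} : Set (V ⊕ V)), u s = 0 := fun s hs => Pi.single_eq_of_ne hs 1
  have huI := hI.isWeightedHomogeneousIdeal hu
  have hX0 (s : V ⊕ V) (hs : s ≠ Sum.inr w) :
      IsWeightedHomogeneous u (X s : MvPolynomial (V ⊕ V) k) 0 := by
    have := isWeightedHomogeneous_X k u s
    rwa [hu s hs] at this
  have hX1 : IsWeightedHomogeneous u (X (Sum.inr w) : MvPolynomial (V ⊕ V) k) 1 := by
    have := isWeightedHomogeneous_X k u (Sum.inr w)
    rwa [show u (Sum.inr w) = 1 from Pi.single_eq_same _ _] at this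
  have hcomp (e : ℕ) : X (Sum.inr w) * (X (Sum.inl v) * weightedHomogeneousComponent u e p) -
      X (Sum.inr v) * (X (Sum.inl w) * weightedHomogeneousComponent u (1 + e) p) ∈ I := by
    have h := huI _ hp (1 + e)
    have e₁ : edgeBinomial k v w * p = X (Sum.inr w) * (X (Sum.inl v) * p) -
        X (Sum.inr v) * (X (Sum.inl w) * p) := by
      unfold edgeBinomial
      ring
    have e₂ := weightedHomogeneousComponent_mul_left hX1 (X (Sum.inl v) * p) e
    have e₃ := weightedHomogeneousComponent_mul_left (hX0 (Sum.inl v) (by simp)) p e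
    have e₄ := weightedHomogeneousComponent_mul_left
      (hX0 (Sum.inr v) (by simpa using hvw)) (X (Sum.inl w) * p) (1 + e)
    have e₅ := weightedHomogeneousComponent_mul_left (hX0 (Sum.inl w) (by simp)) p (1 + e)
    rw [zero_add] at e₃ e₄ e₅
    rwa [e₁, map_sub, e₂, e₃, e₄, e₅] at h
  obtain ⟨N, hN⟩ := exists_weightedHomogeneousComponent_eq_zero u p
  have key (j : ℕ) : ∀ e, N ≤ e + j → weightedHomogeneousComponent u e p ∈ I := by
    induction j with
    | zero =>
      intro e he
      rw [hN e he]
      exact I.zero_mem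
    | succ j ih =>
      intro e he
      have h := I.add_mem (hcomp e) (I.mul_mem_left (X (Sum.inr v))
        (I.mul_mem_left (X (Sum.inl w)) (ih (1 + e) (by omega))))
      rw [sub_add_cancel] at h
      exact hreg _ (hI.mem_of_X_mul_mem h)
  rw [← sum_weightedHomogeneousComponent u p]
  exact finsum_induction (· ∈ I) I.zero_mem (fun _ _ => I.add_mem) fun e => key N e (by omega)

variable {G : SimpleGraph V}

theorem inducedEdgeIdeal_pair (G : SimpleGraph V) {a b : V} (hab : G.Adj a b) :
    inducedEdgeIdeal k G {a, b} = Ideal.span {edgeBinomial k a b} := by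
  apply le_antisymm
  · have hmem := Ideal.mem_span_singleton_self (edgeBinomial k a b)
    refine inducedEdgeIdeal_le.2 ?_
    rintro v (rfl | rfl) w (rfl | rfl) h
    · exact absurd rfl h.ne
    · exact hmem
    · rw [edgeBinomial_swap w v]
      exact neg_mem hmem
    · exact absurd rfl h.ne
  · rw [Ideal.span_singleton_le_iff_mem]
    exact edgeBinomial_mem_inducedEdgeIdeal (by simp) (by simp) hab

theorem inducedEdgeIdeal_path {a b c : V} (hab : G.Adj a b) (hbc : G.Adj b c)
    (hac : ¬ G.Adj a c) : inducedEdgeIdeal k G {a, b, c} =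
      Ideal.span {edgeBinomial k a b} ⊔ Ideal.span {edgeBinomial k b c} := by
  apply le_antisymm
  · have h₁ : edgeBinomial k a b ∈
        Ideal.span {edgeBinomial k a b} ⊔ Ideal.span {edgeBinomial k b c} :=
      Submodule.mem_sup_left (Ideal.mem_span_singleton_self _)
    have h₂ : edgeBinomial k b c ∈
        Ideal.span {edgeBinomial k a b} ⊔ Ideal.span {edgeBinomial k b c} :=
      Submodule.mem_sup_right (Ideal.mem_span_singleton_self _)
    refine inducedEdgeIdeal_le.2 ?_
    rintro v (rfl | rfl | rfl) w (rfl | rfl | rfl) h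
    · exact absurd rfl h.ne
    · exact h₁
    · exact absurd h hac
    · rw [edgeBinomial_swap w v]
      exact neg_mem h₁
    · exact absurd rfl h.ne
    · exact h₂
    · exact absurd h.symm hac
    · rw [edgeBinomial_swap w v]
      exact neg_mem h₂
    · exact absurd rfl h.ne
  · refine sup_le ?_ ?_ <;> rw [Ideal.span_singleton_le_iff_mem]
    · exact edgeBinomial_mem_inducedEdgeIdeal (by simp) (by simp) hab
    · exact edgeBinomial_mem_inducedEdgeIdeal (by simp) (by simp) hbc

/-- Splitting a copy of a disjoint union of graphs. -/
theorem IsInducedCopy.exists_union {W W' : Type*} {H : SimpleGraph W} {H' : SimpleGraph W'}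
    {U : Set V} (h : IsInducedCopy G U (H ⊕g H')) :
    ∃ U₁ U₂, U = U₁ ∪ U₂ ∧ Disjoint U₁ U₂ ∧ (∀ v ∈ U₁, ∀ w ∈ U₂, ¬ G.Adj v w) ∧
      IsInducedCopy G U₁ H ∧ IsInducedCopy G U₂ H' := by
  obtain ⟨g, hg, rfl, hgH⟩ := h
  refine ⟨Set.range (g ∘ Sum.inl), Set.range (g ∘ Sum.inr), ?_, ?_, ?_,
    ⟨_, hg.comp Sum.inl_injective, rfl, fun x y => ?_⟩,
    ⟨_, hg.comp Sum.inr_injective, rfl, fun x y => ?_⟩⟩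
  · rw [← Set.Sum.elim_range, Sum.elim_comp_inl_inr]
  · rw [Set.disjoint_left]
    rintro _ ⟨x, rfl⟩ ⟨y, hy⟩
    exact absurd (hg hy) (by simp)
  · rintro _ ⟨x, rfl⟩ _ ⟨y, rfl⟩
    simp [hgH]
  · simp [hgH]
  · simp [hgH]

theorem IsInducedCopy.exists_pair {U : Set V} (h : IsInducedCopy G U (pathUnion 0 1)) :
    ∃ a b, U = {a, b} ∧ G.Adj a b := by
  obtain ⟨g, hg, rfl, hgH⟩ := h
  refine ⟨g (Sum.inr (0, 0)), g (Sum.inr (0, 1)), ?_, ?_⟩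
  · ext v
    constructor
    · rintro ⟨⟨i, -⟩ | ⟨i, x⟩, rfl⟩
      · exact i.elim0
      · obtain rfl := Subsingleton.elim i 0
        fin_cases x <;> simp
    · rintro (rfl | rfl) <;> exact ⟨_, rfl⟩
  · rw [hgH]
    simp [graphCopies, SimpleGraph.pathGraph_adj]

theorem IsInducedCopy.exists_path {U : Set V} (h : IsInducedCopy G U (pathUnion 1 0)) :
    ∃ a b c, U = {a, b, c} ∧ G.Adj a b ∧ G.Adj b c ∧ ¬ G.Adj a c ∧ a ≠ c := by
  obtain ⟨g, hg, rfl, hgH⟩ := h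
  refine ⟨g (Sum.inl (0, 0)), g (Sum.inl (0, 1)), g (Sum.inl (0, 2)), ?_, ?_, ?_, ?_,
    fun h => absurd (hg h) (by simp)⟩
  · ext v
    constructor
    · rintro ⟨⟨i, x⟩ | ⟨i, -⟩, rfl⟩
      · obtain rfl := Subsingleton.elim i 0
        fin_cases x <;> simp
      · exact i.elim0
    · rintro (rfl | rfl | rfl) <;> exact ⟨_, rfl⟩
  all_goals
    rw [hgH]
    simp [graphCopies, SimpleGraph.pathGraph_adj]

variable [Fintype V] [DecidableEq V]

theorem KoszulExactAt.of_sup_edgeBinomial {I : Ideal (MvPolynomial (V ⊕ V) k)}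
    (hI : IsHomogeneousIdeal I) {v w : V} (hvw : v ≠ w) (hfree : IsFreeOf {Sum.inr w} I)
    (hreg : ∀ p, X (Sum.inl v) * p ∈ I → p ∈ I) {c : ℕ}
    (h : KoszulExactAt (I ⊔ Ideal.span {edgeBinomial k v w}) (c + 1) (c + 1 : ℕ)) :
    KoszulExactAt I c c := by
  refine KoszulExactAt.of_sup_span hI
    (g := Sum.elim (Pi.single v (X (Sum.inr w))) (Pi.single v (-X (Sum.inl w)))) (e := 1) ?_ ?_
    (fun p => mem_of_edgeBinomial_mul_mem hvw hfree hreg) (d := c) ?_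
  · simp [edgeBinomial, Fintype.sum_sum_type, Pi.single_apply, sub_eq_add_neg]
  · rintro (s | s) <;> rcases eq_or_ne s v with rfl | hs
    · simpa using X_mem_polyDegree _
    · simp [hs]
    · simpa using X_mem_polyDegree _
    · simp [hs]
  · rwa [Nat.cast_add, Nat.cast_one, add_comm (c : ℤ)] at h

theorem not_koszulExactAt_bot {σ : Type*} [Fintype σ] [DecidableEq σ] :
    ¬ KoszulExactAt (⊥ : Ideal (MvPolynomial σ k)) 0 0 := by
  intro h
  obtain ⟨b, hb, hcb⟩ := h (AlternatingMap.constOfIsEmpty k (σ → k) (Fin 0) 1)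
    (fun v => isWeightedHomogeneous_one k _) trivial
  have hb0 (v) : b v = 0 := by
    have := hb v
    rwa [polyDegree_of_neg (by omega), Submodule.mem_bot] at this
  have := hcb 0
  simp [polyDifferential_apply, hb0] at this

theorem not_koszulExactAt_of_pair {U : Set V} {a b : V} (hab : G.Adj a b)
    (hU : Disjoint U {a, b}) {c : ℕ} (h : ¬ KoszulExactAt (inducedEdgeIdeal k G U) c c) :
    ¬ KoszulExactAt (inducedEdgeIdeal k G U ⊔ inducedEdgeIdeal k G {a, b})
      (c + 1) (c + 1 : ℕ) := by
  have hfree := isFreeOf_inducedEdgeIdeal (k := k) (G := G) hU.symm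
  rw [inducedEdgeIdeal_pair G hab]
  exact fun h' => h (h'.of_sup_edgeBinomial (isHomogeneousIdeal_inducedEdgeIdeal _ _) hab.ne
    (hfree.mono (by simp)) fun p hp => (hfree.mono (by simp)).mem_of_X_mul_mem hp)

theorem not_koszulExactAt_of_path {U : Set V} {a b c : V} (hab : G.Adj a b) (hbc : G.Adj b c)
    (hac : ¬ G.Adj a c) (hne : a ≠ c) (hU : Disjoint U {a, b, c}) {n : ℕ}
    (h : ¬ KoszulExactAt (inducedEdgeIdeal k G U) n n) :
    ¬ KoszulExactAt (inducedEdgeIdeal k G U ⊔ inducedEdgeIdeal k G {a, b, c})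
      (n + 2) (n + 2 : ℕ) := by
  have hU' : Disjoint U {a, b} := hU.mono_right (by
    rintro x (rfl | rfl) <;> simp)
  have hpair := not_koszulExactAt_of_pair hab hU' h
  have hfree := isFreeOf_inducedEdgeIdeal (k := k) (G := G) hU.symm
  rw [inducedEdgeIdeal_path hab hbc hac, ← sup_assoc, ← inducedEdgeIdeal_pair G hab]
  refine fun h' => hpair (h'.of_sup_edgeBinomial ((isHomogeneousIdeal_inducedEdgeIdeal _ _).sup
    (isHomogeneousIdeal_inducedEdgeIdeal _ _)) hbc.ne ?_ fun p hp => ?_)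
  · refine (hfree.mono (by simp)).sup ((isFreeOf_inducedEdgeIdeal (U₁ := {c}) ?_).mono (by simp))
    simp [hne.symm, hbc.ne']
  -- `{a, b}` spans a complete component, so `x_b` is regular.
  · have e : inducedEdgeIdeal k G {a, b} = inducedEdgeIdeal k ⊤ {a, b} := by
      rw [inducedEdgeIdeal_pair G hab, inducedEdgeIdeal_pair ⊤ (a := a) (b := b) hab.ne]
    rw [e, sup_comm] at hp ⊢
    exact mem_of_X_inl_mul_mem (hfree.mono (vertexVars_mono (by
      rintro x (rfl | rfl) <;> simp))) (by simp) hp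

/-- The edge ideal of a disjoint union of `p` paths on three and `q` paths on two vertices is a
complete intersection of `2p + q` quadrics, so its last syzygy has degree `2(2p + q)`. -/
theorem not_koszulExactAt_of_isInducedCopy (p q : ℕ) :
    ∀ U : Set V, IsInducedCopy G U (pathUnion p q) →
      ¬ KoszulExactAt (inducedEdgeIdeal k G U) (2 * p + q) (2 * p + q : ℕ) := by
  induction p with
  | zero =>
    induction q with
    | zero =>
      intro U hU
      obtain ⟨g, -, rfl, -⟩ := hU
      have e : inducedEdgeIdeal k G (Set.range g) = ⊥ := by
        rw [eq_bot_iff, inducedEdgeIdeal_le]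
        rintro _ ⟨x, rfl⟩
        exact isEmptyElim x
      rw [e]
      exact not_koszulExactAt_bot
    | succ q ih =>
      intro U hU
      obtain ⟨U₁, U₂, rfl, hdis, hadj, h₁, h₂⟩ := (hU.of_iso (pathUnionIso 0 q 0 1)).exists_union
      obtain ⟨a, b, rfl, hab⟩ := h₂.exists_pair
      rw [inducedEdgeIdeal_union hadj]
      exact not_koszulExactAt_of_pair hab hdis (ih U₁ h₁)
  | succ p ih =>
    intro U hU
    obtain ⟨U₁, U₂, rfl, hdis, hadj, h₁, h₂⟩ := (hU.of_iso (pathUnionIso p q 1 0)).exists_union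
    obtain ⟨a, b, c, rfl, hab, hbc, hac, hne⟩ := h₂.exists_path
    have e : 2 * (p + 1) + q = 2 * p + q + 2 := by ring
    rw [inducedEdgeIdeal_union hadj, e]
    exact not_koszulExactAt_of_path hab hbc hac hne hdis (ih U₁ h₁)

end CompleteIntersections

/-! ### The characterization of maximal regularity -/

theorem mainTheorem2 (k : Type*) [Field k] {V : Type*} [Fintype V] [DecidableEq V]
    (G : SimpleGraph V) (hG : IsCograph G) (m a : ℕ) (hm : 1 ≤ m) (ha : a = 0 ∨ a = 1)
    (hV : Fintype.card V + a = 3 * m) :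
    regularity (binomialEdgeIdeal k G) = 2 * (m : ℤ) - a ↔
      ∃ p q : ℕ, q ≤ 1 ∧
        Nonempty (G ≃g (graphCopies p (SimpleGraph.pathGraph 3) ⊕g
          graphCopies q (SimpleGraph.pathGraph 2))) := by
  obtain ⟨ρ, hρ, hle, hst⟩ := hG.hasNoInducedP4.exists_edgeRegLE k _ Finset.univ rfl
  rw [Finset.card_univ] at hle hst
  rw [Finset.coe_univ] at hρ hst
  have hreg : RegLE (binomialEdgeIdeal k G) ρ := by
    have h := hρ ⊥ 0 (isFreeOf_bot _) isHomogeneousIdeal_bot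
      (regLE_of_forall_X_mem fun s => Submodule.mem_sup_left (X_mem_varIdeal (Set.mem_univ _)))
    rwa [sup_bot_eq, zero_add, ← binomialEdgeIdeal_eq] at h
  have hreg' := regularity_le (Int.natCast_nonneg ρ) hreg
  constructor
  · intro h
    have hd : 2 * Fintype.card V - 3 * ρ ≤ 1 := by omega
    obtain ⟨p, hp⟩ := hst _ hd (by omega)
    exact ⟨p, _, hd, isInducedCopy_univ_iff.1 hp⟩
  · rintro ⟨p, q, hq, ⟨e⟩⟩
    have hcard : Fintype.card V = p * 3 + q * 2 := by
      rw [Fintype.card_congr e.toEquiv]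
      simp
    have hlow := not_koszulExactAt_of_isInducedCopy (k := k) p q _
      (isInducedCopy_univ_iff.2 ⟨e⟩)
    rw [← binomialEdgeIdeal_eq] at hlow
    have hdeg : ((2 * (2 * p + q) : ℕ) : ℤ) - (2 * p + q : ℕ) = (2 * p + q : ℕ) := by
      push_cast
      ring
    have h := le_regularity hreg (i := 2 * p + q) (j := 2 * (2 * p + q)) (by rwa [hdeg])
    omega
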